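/- All manifolds are $C^\infty$, Hausdorff, second countable, finite-dimensional and without boundary. An almost contact metric manifold $(N,\phi,\xi,\eta,g)$ is a $(2n+1)$-dimensional manifold with a smooth $(1,1)$-tensor field $\phi$, a smooth vector field $\xi$, a smooth $1$-form $\eta$ and a Riemannian metric $g$ such that $\phi^2=-I+\eta\otimes\xi$, $\eta(\xi)=1$ and $g(\phi X,\phi Y)=g(X,Y)-\eta(X)\eta(Y)$. Put $\Phi(X,Y)=g(X,\phi Y)$; exterior derivatives are normalized by $d\eta(X,Y)=\tfrac12\bigl(X\eta(Y)-Y\eta(X)-\eta([X,Y])\bigr)$. The structure is normal if $\phi^2[X,Y]+[\phi X,\phi Y]-\phi[\phi X,Y]-\phi[X,\phi Y]+2\,d\eta(X,Y)\xi=0$ for all $X,Y$. The manifold $N$ is cosymplectic if $d\eta=0$, $d\Phi=0$ and the structure is normal; Sasakian if $\Phi=d\eta$ and the structure is normal; Kenmotsu if $(\overline\nabla_X\phi)Y=g(\phi X,Y)\xi-\eta(Y)\phi X$ for the Levi-Civita connection $\overline\nabla$ of $g$. Let $(B,g_B)$ be a connected Riemannian manifold, $(\overline F,g_{\overline F})$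 a nonempty Riemannian manifold with $\dim\overline F\ge 1$, and $f:B\to(0,\infty)$ a smooth function. The warped product $M=B\times_f\overline F$ is $B\times\overline F$ with the metric $g_B+f^2g_{\overline F}$; it is nontrivial if $f$ is not constant. It is a submanifold of $N$ if it is isometrically immersed in $N$ by a smooth map. Such an $M$ is a proper pointwise semi-slant submanifold of $N$ with distributions $\mathcal D_1,\mathcal D_2$ if $\mathcal D_1\subset TM$ is a smooth distribution with $\phi(\mathcal D_1)\subset\mathcal D_1$, $\mathcal D_2$ is the orthogonal complement of $\mathcal D_1$ in $TM$, and there is a function $\theta:M\to(0,\pi/2)$ such that, for every $p\in M$ and every nonzero $X\in(\mathcal D_2)_p$, one has $\phi X\neq0$ and the angle between $\phi X$ and the subspace $(\mathcal D_2)_p$ equals $\theta(p)$. **Theorem.** Let $N$ be a cosymplectic, Sasakian or Kenmotsu manifold, and let $M=B\times_f\overline F$ be a nontrivial warped product submanifold of $N$ as above. Assume that either $\xi$ is normal to $M$ at every point of $M$, or $\xi$ is tangent to $M$ at every point of $M$. Then $M$ is not a proper pointwise semi-slant submanifold of $N$ with $\mathcal D_1=T\overline F$ and $\mathcal D_2=TB$.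 -/

import Mathlib

open scoped Manifold ContDiff Topology InnerProductSpace
open Bundle

noncomputable section

/-! ### Almost contact metric manifolds -/

section Ambient

variable {E : Type*} [NormedAddCommGroup E] [NormedSpace ℝ E] [FiniteDimensional ℝ E]
  {H : Type*} [TopologicalSpace H] (I : ModelWithCorners ℝ E H)
  (N : Type*) [TopologicalSpace N] [ChartedSpace H N] [IsManifold I ∞ N]
  [RiemannianBundle (fun x : N => TangentSpace I x)]

/-- An almost contact metric structure `(φ, ξ, η, g)` on the Riemannian manifold `N`, whose metric
`g` is the Riemannian structure carried by the tangent bundle of `N`. -/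
structure AlmostContactMetric where
  /-- the tensor field of type `(1,1)` -/
  φ : ∀ x : N, TangentSpace I x →L[ℝ] TangentSpace I x
  /-- the characteristic vector field -/
  ξ : ∀ x : N, TangentSpace I x
  /-- the 1-form -/
  η : ∀ x : N, TangentSpace I x →L[ℝ] ℝ
  contMDiff_φ : ContMDiff I (I.prod 𝓘(ℝ, E →L[ℝ] E)) ∞
    (fun x => (⟨x, φ x⟩ :
      TotalSpace (E →L[ℝ] E) (fun x : N => TangentSpace I x →L[ℝ] TangentSpace I x)))
  contMDiff_ξ : ContMDiff I I.tangent ∞ (fun x => (⟨x, ξ x⟩ : TangentBundle I N))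
  contMDiff_η : ContMDiff I (I.prod 𝓘(ℝ, E →L[ℝ] ℝ)) ∞
    (fun x => (⟨x, η x⟩ :
      TotalSpace (E →L[ℝ] ℝ) (fun x : N => TangentSpace I x →L[ℝ] Bundle.Trivial N ℝ x)))
  φ_φ : ∀ (x : N) (v : TangentSpace I x), φ x (φ x v) = -v + η x v • ξ x
  η_ξ : ∀ x : N, η x (ξ x) = 1
  inner_φ_φ : ∀ (x : N) (v w : TangentSpace I x), ⟪φ x v, φ x w⟫_ℝ = ⟪v, w⟫_ℝ - η x v * η x w

variable {I N}

/-- The vector field `X` (defined on all of `N`, but arbitrary away from `p`) is `C^∞` at `p`. -/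
def SmoothFieldAt (X : ∀ x : N, TangentSpace I x) (p : N) : Prop :=
  ContMDiffAt I I.tangent ∞ (fun x => (⟨x, X x⟩ : TangentBundle I N)) p

/-- The exterior derivative of a 1-form,
`dα(X, Y) = ½ (X (α Y) - Y (α X) - α [X, Y])`, at the point `p`. -/
def extDerivOne (α : ∀ x : N, TangentSpace I x →L[ℝ] ℝ) (X Y : ∀ x : N, TangentSpace I x)
    (p : N) : ℝ :=
  (1 / 2) * (mvfderiv I (fun x => α x (Y x)) p (X p) - mvfderiv I (fun x => α x (X x)) p (Y p)
    - α p (VectorField.mlieBracket I X Y p))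

/-- The exterior derivative of a 2-form,
`dβ(X, Y, Z) = ⅓ (X β(Y, Z) + Y β(Z, X) + Z β(X, Y) - β([X, Y], Z) - β([Y, Z], X) - β([Z, X], Y))`,
at the point `p`. -/
def extDerivTwo (β : ∀ x : N, TangentSpace I x → TangentSpace I x → ℝ)
    (X Y Z : ∀ x : N, TangentSpace I x) (p : N) : ℝ :=
  (1 / 3) * (mvfderiv I (fun x => β x (Y x) (Z x)) p (X p)
    + mvfderiv I (fun x => β x (Z x) (X x)) p (Y p)
    + mvfderiv I (fun x => β x (X x) (Y x)) p (Z p)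
    - β p (VectorField.mlieBracket I X Y p) (Z p)
    - β p (VectorField.mlieBracket I Y Z p) (X p)
    - β p (VectorField.mlieBracket I Z X p) (Y p))

/-- `∇` is the Levi-Civita connection of `N`: it is torsion-free and metric. -/
def IsLeviCivita [IsContMDiffRiemannianBundle I ∞ E (fun x : N => TangentSpace I x)]
    (cov : CovariantDerivative I E (TangentSpace I : N → Type _)) : Prop :=
  cov.torsion = 0 ∧
    CovariantDerivative.IsMetricCompatible (V := fun x : N => TangentSpace I x) cov

namespace AlmostContactMetric

variable (S : AlmostContactMetric I N)

/-- `(φ X)(x) = φ (X x)` for a vector field `X`. -/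
def φField (X : ∀ x : N, TangentSpace I x) (x : N) : TangentSpace I x := S.φ x (X x)

/-- The fundamental 2-form `Φ(X, Y) = g(X, φ Y)`. -/
def fundamentalForm (x : N) (v w : TangentSpace I x) : ℝ := ⟪v, S.φ x w⟫_ℝ

/-- The Nijenhuis tensor of `φ`,
`φ² [X, Y] + [φ X, φ Y] - φ [φ X, Y] - φ [X, φ Y]`, at the point `p`. -/
def nijenhuis (X Y : ∀ x : N, TangentSpace I x) (p : N) : TangentSpace I p :=
  S.φ p (S.φ p (VectorField.mlieBracket I X Y p))
    + VectorField.mlieBracket I (S.φField X) (S.φField Y) p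
    - S.φ p (VectorField.mlieBracket I (S.φField X) Y p)
    - S.φ p (VectorField.mlieBracket I X (S.φField Y) p)

/-- Normality: `N_φ(X, Y) + 2 dη(X, Y) ξ = 0`. -/
def IsNormal : Prop :=
  ∀ (p : N) (X Y : ∀ x : N, TangentSpace I x), SmoothFieldAt X p → SmoothFieldAt Y p →
    S.nijenhuis X Y p + (2 * extDerivOne S.η X Y p) • S.ξ p = 0

/-- Contact metric manifold: `Φ = dη`. -/
def IsContact : Prop :=
  ∀ (p : N) (X Y : ∀ x : N, TangentSpace I x), SmoothFieldAt X p → SmoothFieldAt Y p →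
    S.fundamentalForm p (X p) (Y p) = extDerivOne S.η X Y p

/-- Sasakian manifold: contact and normal. -/
def IsSasakian : Prop := S.IsContact ∧ S.IsNormal

/-- Almost cosymplectic manifold: `dη = 0` and `dΦ = 0`. -/
def IsAlmostCosymplectic : Prop :=
  (∀ (p : N) (X Y : ∀ x : N, TangentSpace I x), SmoothFieldAt X p → SmoothFieldAt Y p →
    extDerivOne S.η X Y p = 0) ∧
  (∀ (p : N) (X Y Z : ∀ x : N, TangentSpace I x),
    SmoothFieldAt X p → SmoothFieldAt Y p → SmoothFieldAt Z p →
    extDerivTwo S.fundamentalForm X Y Z p = 0)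

/-- Cosymplectic manifold: almost cosymplectic and normal. -/
def IsCosymplectic : Prop := S.IsAlmostCosymplectic ∧ S.IsNormal

/-- Kenmotsu manifold: `(∇_X φ) Y = g(φ X, Y) ξ - η(Y) φ X`, where `∇` is the (unique) Levi-Civita
connection and `(∇_X φ) Y = ∇_X (φ Y) - φ (∇_X Y)`. In `cov Y p (X p)` the arguments are ordered so
that this is `∇_X Y` at `p`. -/
def IsKenmotsu [IsContMDiffRiemannianBundle I ∞ E (fun x : N => TangentSpace I x)] : Prop :=
  ∃ cov : CovariantDerivative I E (TangentSpace I : N → Type _), IsLeviCivita cov ∧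
    ∀ (p : N) (X Y : ∀ x : N, TangentSpace I x), SmoothFieldAt X p → SmoothFieldAt Y p →
      cov (S.φField Y) p (X p) - S.φ p (cov Y p (X p)) =
        ⟪S.φ p (X p), Y p⟫_ℝ • S.ξ p - S.η p (Y p) • S.φ p (X p)

end AlmostContactMetric

end Ambient

/-! ### Pointwise semi-slant submanifolds -/

section Submanifold

variable {E : Type*} [NormedAddCommGroup E] [NormedSpace ℝ E] [FiniteDimensional ℝ E]
  {H : Type*} [TopologicalSpace H] {I : ModelWithCorners ℝ E H}
  {N : Type*} [TopologicalSpace N] [ChartedSpace H N] [IsManifold I ∞ N]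
  [RiemannianBundle (fun x : N => TangentSpace I x)]
  {E' : Type*} [NormedAddCommGroup E'] [NormedSpace ℝ E']
  {H' : Type*} [TopologicalSpace H'] (J : ModelWithCorners ℝ E' H')
  {M : Type*} [TopologicalSpace M] [ChartedSpace H' M] [IsManifold J ∞ M]

/-- A smooth distribution on `M`: near every point it is spanned by a smooth frame. -/
def IsSmoothDistribution (D : ∀ p : M, Submodule ℝ (TangentSpace J p)) : Prop :=
  ∀ p : M, ∃ (r : ℕ) (X : Fin r → ∀ q : M, TangentSpace J q) (U : Set M), U ∈ 𝓝 p ∧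
    (∀ i, ContMDiffOn J J.tangent ∞ (fun q => (⟨q, X i q⟩ : TangentBundle J M)) U) ∧
    ∀ q ∈ U, LinearIndependent ℝ (fun i => X i q) ∧
      Submodule.span ℝ (Set.range (fun i => X i q)) = D q

/-- The angle between a vector `u` and a subspace `W` of the tangent space `T_x N`: the least angle
between `u` and a nonzero vector of `W`. -/
def angleSubspace {x : N} (u : TangentSpace I x) (W : Submodule ℝ (TangentSpace I x)) : ℝ :=
  sInf ((fun w => InnerProductGeometry.angle u w) '' {w | w ∈ W ∧ w ≠ 0})

/-- `M`, immersed in `N` by `ι`, is a pointwise semi-slant submanifold with distributions `D₁`, `D₂`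
and semi-slant function `θ`: `D₁` is a `φ`-invariant distribution, `D₂` is its orthogonal complement
in `TM`, and at each `p` the angle between `φ X` and `(D₂)_p` is defined and equal to `θ p` for all
nonzero `X ∈ (D₂)_p`. -/
structure IsPointwiseSemiSlant (S : AlmostContactMetric I N) (ι : M → N)
    (D₁ D₂ : ∀ p : M, Submodule ℝ (TangentSpace J p)) (θ : M → ℝ) : Prop where
  smooth : IsSmoothDistribution J D₁
  mem_D₂ : ∀ (p : M) (v : TangentSpace J p),
    v ∈ D₂ p ↔ ∀ w ∈ D₁ p, ⟪mfderiv J I ι p v, mfderiv J I ι p w⟫_ℝ = 0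
  φ_D₁ : ∀ (p : M), ∀ v ∈ D₁ p, ∃ w ∈ D₁ p, S.φ (ι p) (mfderiv J I ι p v) = mfderiv J I ι p w
  slant : ∀ (p : M), ∀ v ∈ D₂ p, v ≠ 0 →
    S.φ (ι p) (mfderiv J I ι p v) ≠ 0 ∧
    angleSubspace (S.φ (ι p) (mfderiv J I ι p v))
      ((D₂ p).map (mfderiv J I ι p : TangentSpace J p →ₗ[ℝ] TangentSpace I (ι p))) = θ p

/-- A proper pointwise semi-slant submanifold: the semi-slant function has values in `(0, π/2)`. -/
def IsProperPointwiseSemiSlant (S : AlmostContactMetric I N) (ι : M → N)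
    (D₁ D₂ : ∀ p : M, Submodule ℝ (TangentSpace J p)) : Prop :=
  ∃ θ : M → ℝ, (∀ p, θ p ∈ Set.Ioo 0 (Real.pi / 2)) ∧ IsPointwiseSemiSlant J S ι D₁ D₂ θ

/-- `ξ` is normal to `M`. -/
def XiNormal (S : AlmostContactMetric I N) (ι : M → N) : Prop :=
  ∀ (p : M) (v : TangentSpace J p), ⟪S.ξ (ι p), mfderiv J I ι p v⟫_ℝ = 0

/-- `ξ` is tangent to `M`. -/
def XiTangent (S : AlmostContactMetric I N) (ι : M → N) : Prop :=
  ∀ p : M, ∃ v : TangentSpace J p, mfderiv J I ι p v = S.ξ (ι p)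

end Submanifold

/-! ### Warped products -/

section Warped

variable {E₁ : Type*} [NormedAddCommGroup E₁] [NormedSpace ℝ E₁]
  {H₁ : Type*} [TopologicalSpace H₁] (I₁ : ModelWithCorners ℝ E₁ H₁)
  {B : Type*} [TopologicalSpace B] [ChartedSpace H₁ B]
  {E₂ : Type*} [NormedAddCommGroup E₂] [NormedSpace ℝ E₂]
  {H₂ : Type*} [TopologicalSpace H₂] (I₂ : ModelWithCorners ℝ E₂ H₂)
  {F : Type*} [TopologicalSpace F] [ChartedSpace H₂ F]

/-- The distribution `TB` on `B × F`: the kernel of the differential of the projection to `F`. -/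
def baseDistribution (p : B × F) : Submodule ℝ (TangentSpace (I₁.prod I₂) p) :=
  LinearMap.ker (mfderiv (I₁.prod I₂) I₂ (Prod.snd : B × F → F) p :
    TangentSpace (I₁.prod I₂) p →ₗ[ℝ] TangentSpace I₂ p.2)

/-- The distribution `TF` on `B × F`: the kernel of the differential of the projection to `B`. -/
def fiberDistribution (p : B × F) : Submodule ℝ (TangentSpace (I₁.prod I₂) p) :=
  LinearMap.ker (mfderiv (I₁.prod I₂) I₁ (Prod.fst : B × F → B) p :
    TangentSpace (I₁.prod I₂) p →ₗ[ℝ] TangentSpace I₁ p.1)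

variable [IsManifold I₁ 1 B] [IsManifold I₂ 1 F]
  [RiemannianBundle (fun x : B => TangentSpace I₁ x)]
  [RiemannianBundle (fun x : F => TangentSpace I₂ x)]

/-- The warped product metric `g_B + f² g_F` on `B × F`. -/
def warpedMetric (f : B → ℝ) (p : B × F) (v w : TangentSpace (I₁.prod I₂) p) : ℝ :=
  (inner ℝ (mfderiv (I₁.prod I₂) I₁ (Prod.fst : B × F → B) p v : TangentSpace I₁ p.1)
      (mfderiv (I₁.prod I₂) I₁ (Prod.fst : B × F → B) p w : TangentSpace I₁ p.1))
    + f p.1 ^ 2 *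
      (inner ℝ (mfderiv (I₁.prod I₂) I₂ (Prod.snd : B × F → F) p v : TangentSpace I₂ p.2)
        (mfderiv (I₁.prod I₂) I₂ (Prod.snd : B × F → F) p w : TangentSpace I₂ p.2))

variable {E : Type*} [NormedAddCommGroup E] [NormedSpace ℝ E]
  {H : Type*} [TopologicalSpace H] (I : ModelWithCorners ℝ E H)
  {N : Type*} [TopologicalSpace N] [ChartedSpace H N] [IsManifold I 1 N]
  [RiemannianBundle (fun x : N => TangentSpace I x)]

/-- `ι` makes the warped product `B ×_f F` a Riemannian submanifold of `N`: it is a smooth isometric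
immersion (injectivity of the differential follows from the isometry condition for `f > 0`). -/
def IsWarpedProductSubmanifold (f : B → ℝ) (ι : B × F → N) : Prop :=
  ContMDiff (I₁.prod I₂) I ∞ ι ∧
  ∀ (p : B × F) (v w : TangentSpace (I₁.prod I₂) p),
    ⟪mfderiv (I₁.prod I₂) I ι p v, mfderiv (I₁.prod I₂) I ι p w⟫_ℝ = warpedMetric I₁ I₂ f p v w

end Warped

end

noncomputable section

/-! ### Pulling back exterior derivatives in normed spaces -/

section Calculus

variable {W E : Type*} [NormedAddCommGroup W] [NormedSpace ℝ W]
  [NormedAddCommGroup E] [NormedSpace ℝ E] {G : W → E} {y : W}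

lemma hasFDerivAt_pullback {F : Type*} [NormedAddCommGroup F] [NormedSpace ℝ F]
    {α : E → E →L[ℝ] F} (hα : DifferentiableAt ℝ α (G y)) (hG : ContDiffAt ℝ 2 G y) (v : W) :
    HasFDerivAt (fun y => α (G y) (fderiv ℝ G y v))
      (((fderiv ℝ α (G y)).comp (fderiv ℝ G y)).flip (fderiv ℝ G y v)
        + (α (G y)).comp ((fderiv ℝ (fderiv ℝ G) y).flip v)) y := by
  have hG1 : HasFDerivAt G (fderiv ℝ G y) y := (hG.differentiableAt (by norm_num)).hasFDerivAt
  have hG2 : HasFDerivAt (fderiv ℝ G) (fderiv ℝ (fderiv ℝ G) y) y :=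
    ((hG.fderiv_right (m := 1) (by norm_num)).differentiableAt (by norm_num)).hasFDerivAt
  have h1 := hα.hasFDerivAt.comp y hG1
  have h2 := hG2.clm_apply (hasFDerivAt_const v y)
  convert h1.clm_apply h2 using 1
  · rfl
  · rw [add_comm]
    simp

lemma fderiv_pullback_oneForm {α : E → E →L[ℝ] ℝ} (hα : DifferentiableAt ℝ α (G y))
    (hG : ContDiffAt ℝ 2 G y) (u v : W) :
    fderiv ℝ (fun y => α (G y) (fderiv ℝ G y v)) y u =
      fderiv ℝ α (G y) (fderiv ℝ G y u) (fderiv ℝ G y v)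
        + α (G y) (fderiv ℝ (fderiv ℝ G) y u v) := by
  rw [(hasFDerivAt_pullback hα hG v).fderiv]
  simp

lemma fderiv_pullback_twoForm {β : E → E →L[ℝ] E →L[ℝ] ℝ} (hβ : DifferentiableAt ℝ β (G y))
    (hG : ContDiffAt ℝ 2 G y) (u v w : W) :
    fderiv ℝ (fun y => β (G y) (fderiv ℝ G y v) (fderiv ℝ G y w)) y u =
      fderiv ℝ β (G y) (fderiv ℝ G y u) (fderiv ℝ G y v) (fderiv ℝ G y w)
        + β (G y) (fderiv ℝ (fderiv ℝ G) y u v) (fderiv ℝ G y w)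
        + β (G y) (fderiv ℝ G y v) (fderiv ℝ (fderiv ℝ G) y u w) := by
  have hG2 : HasFDerivAt (fderiv ℝ G) (fderiv ℝ (fderiv ℝ G) y) y :=
    ((hG.fderiv_right (m := 1) (by norm_num)).differentiableAt (by norm_num)).hasFDerivAt
  have h2 := hG2.clm_apply (hasFDerivAt_const w y)
  have h3 := ((hasFDerivAt_pullback hβ hG v).clm_apply h2).fderiv
  rw [h3]
  simp
  ring

end Calculus

/-! ### Coordinate vector fields -/

section CoordField

variable {E : Type*} [NormedAddCommGroup E] [NormedSpace ℝ E]
  {H : Type*} [TopologicalSpace H] (I : ModelWithCorners ℝ E H)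
  {N : Type*} [TopologicalSpace N] [ChartedSpace H N]

/-- The vector field on the domain of the preferred chart at `x₀` which has constant
coordinates `u`. -/
def coordField (x₀ : N) (u : E) : ∀ x : N, TangentSpace I x :=
  VectorField.mpullback I 𝓘(ℝ, E) (extChartAt I x₀) (fun _ => u)

variable {I} [IsManifold I ∞ N] {x₀ x : N}

lemma mfderiv_extChartAt_coordField (hx : x ∈ (extChartAt I x₀).source) (u : E) :
    mfderiv I 𝓘(ℝ, E) (extChartAt I x₀) x (coordField I x₀ u x) = u := by
  have h := isInvertible_mfderiv_extChartAt (I := I) hx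
  exact h.self_apply_inverse u

lemma coordField_mfderiv_extChartAt (hx : x ∈ (extChartAt I x₀).source)
    (v : TangentSpace I x) :
    coordField I x₀ (mfderiv I 𝓘(ℝ, E) (extChartAt I x₀) x v) x = v := by
  have h := isInvertible_mfderiv_extChartAt (I := I) hx
  exact h.inverse_apply_self v

lemma smoothFieldAt_coordField [FiniteDimensional ℝ E] (hx : x ∈ (extChartAt I x₀).source) (u : E) :
    SmoothFieldAt (coordField I x₀ u) x := by
  have : CompleteSpace E := FiniteDimensional.complete ℝ E
  have : IsManifold I 1 N := .of_le (n := ∞) (by norm_num)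
  refine ContMDiffAt.mpullback_vectorField_preimage (n := ∞) ?_
    (contMDiffAt_extChartAt' (by simpa using hx)) (isInvertible_mfderiv_extChartAt hx) (by simp)
  exact contMDiffAt_vectorSpace_iff_contDiffAt.2 contDiffAt_const

lemma two_le_infty : (2 : WithTop ℕ∞) ≤ ∞ := ENat.LEInfty.out

lemma mlieBracket_const {E : Type*} [NormedAddCommGroup E] [NormedSpace ℝ E] (u v z : E) :
    VectorField.mlieBracket 𝓘(ℝ, E) (fun x : E => (u : TangentSpace 𝓘(ℝ, E) x))
      (fun x : E => (v : TangentSpace 𝓘(ℝ, E) x)) z = 0 := by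
  have h (U V : ∀ x : E, TangentSpace 𝓘(ℝ, E) x) :
      VectorField.mlieBracket 𝓘(ℝ, E) U V z = VectorField.lieBracket ℝ U V z := by
    rw [← VectorField.mlieBracketWithin_univ, VectorField.mlieBracketWithin_eq_lieBracketWithin]
    exact congrFun VectorField.lieBracketWithin_univ z
  refine (h _ _).trans ?_
  simp only [VectorField.lieBracket, fderiv_fun_const, Pi.zero_apply]
  exact sub_self _

lemma mlieBracket_coordField [FiniteDimensional ℝ E] (hx : x ∈ (extChartAt I x₀).source) (u v : E) :
    VectorField.mlieBracket I (coordField I x₀ u) (coordField I x₀ v) x = 0 := by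
  have : CompleteSpace E := FiniteDimensional.complete ℝ E
  have : IsManifold I (minSmoothness ℝ 2) N := .of_le (n := ∞) (by simpa using two_le_infty)
  have hc (w : E) : MDifferentiableAt 𝓘(ℝ, E) 𝓘(ℝ, E).tangent
      (fun x : E => (⟨x, w⟩ : TangentBundle 𝓘(ℝ, E) E)) (extChartAt I x₀ x) :=
    (contMDiffAt_vectorSpace_iff_contDiffAt (n := 1).2 contDiffAt_const).mdifferentiableAt (by simp)
  rw [coordField, coordField, ← VectorField.mpullback_mlieBracket (n := ∞) (hc u) (hc v)
    (contMDiffAt_extChartAt' (by simpa using hx)) (by simpa using two_le_infty)]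
  rw [VectorField.mpullback_apply, mlieBracket_const]
  exact map_zero _



lemma mvfderiv_comp_extChartAt {h : E → ℝ} (hx : x ∈ (extChartAt I x₀).source)
    (hh : DifferentiableAt ℝ h (extChartAt I x₀ x)) (u : E) :
    mvfderiv I (fun x => h (extChartAt I x₀ x)) x (coordField I x₀ u x) =
      fderiv ℝ h (extChartAt I x₀ x) u := by
  have he : MDifferentiableAt I 𝓘(ℝ, E) (extChartAt I x₀) x :=
    (contMDiffAt_extChartAt' (n := 1) (by simpa using hx)).mdifferentiableAt (by simp)
  have h1 := mfderiv_comp_apply x hh.mdifferentiableAt he (coordField I x₀ u x)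
  rw [mfderiv_extChartAt_coordField hx, mfderiv_eq_fderiv] at h1
  exact h1

/-- A 1-form in the coordinates given by the preferred chart at `x₀`. -/
def oneFormInChart (α : ∀ x : N, TangentSpace I x →L[ℝ] ℝ) (x₀ : N) (z : E) : E →L[ℝ] ℝ :=
  (α ((extChartAt I x₀).symm z)).comp
    (mfderiv I 𝓘(ℝ, E) (extChartAt I x₀) ((extChartAt I x₀).symm z)).inverse

/-- A bilinear form on the tangent bundle in the coordinates given by the preferred chart
at `x₀`. -/
def twoFormInChart (β : ∀ x : N, TangentSpace I x →L[ℝ] TangentSpace I x →L[ℝ] ℝ) (x₀ : N)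
    (z : E) : E →L[ℝ] E →L[ℝ] ℝ :=
  let b : E →L[ℝ] E →L[ℝ] ℝ := β ((extChartAt I x₀).symm z)
  let A : E →L[ℝ] E :=
    (mfderiv I 𝓘(ℝ, E) (extChartAt I x₀) ((extChartAt I x₀).symm z)).inverse
  b.bilinearComp A A

omit [IsManifold I ∞ N] in
lemma oneFormInChart_apply (α : ∀ x : N, TangentSpace I x →L[ℝ] ℝ)
    (hx : x ∈ (extChartAt I x₀).source) (u : E) :
    oneFormInChart α x₀ (extChartAt I x₀ x) u = α x (coordField I x₀ u x) := by
  have : oneFormInChart α x₀ (extChartAt I x₀ x) u =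
      α ((extChartAt I x₀).symm (extChartAt I x₀ x))
        (coordField I x₀ u ((extChartAt I x₀).symm (extChartAt I x₀ x))) := rfl
  rw [this, (extChartAt I x₀).left_inv hx]

omit [IsManifold I ∞ N] in
lemma twoFormInChart_apply (β : ∀ x : N, TangentSpace I x →L[ℝ] TangentSpace I x →L[ℝ] ℝ)
    (hx : x ∈ (extChartAt I x₀).source) (u v : E) :
    twoFormInChart β x₀ (extChartAt I x₀ x) u v =
      β x (coordField I x₀ u x) (coordField I x₀ v x) := by
  have : twoFormInChart β x₀ (extChartAt I x₀ x) u v =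
      β ((extChartAt I x₀).symm (extChartAt I x₀ x))
        (coordField I x₀ u ((extChartAt I x₀).symm (extChartAt I x₀ x)))
        (coordField I x₀ v ((extChartAt I x₀).symm (extChartAt I x₀ x))) := rfl
  rw [this, (extChartAt I x₀).left_inv hx]

/-- A 1-form is smooth if it takes smooth vector fields to smooth functions. -/
def SmoothOneForm (α : ∀ x : N, TangentSpace I x →L[ℝ] ℝ) : Prop :=
  ∀ (p : N) (X : ∀ x : N, TangentSpace I x), SmoothFieldAt X p →
    ContMDiffAt I 𝓘(ℝ, ℝ) ∞ (fun x => α x (X x)) p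

/-- A bilinear form is smooth if it takes smooth vector fields to smooth functions. -/
def SmoothTwoForm (β : ∀ x : N, TangentSpace I x →L[ℝ] TangentSpace I x →L[ℝ] ℝ) : Prop :=
  ∀ (p : N) (X Y : ∀ x : N, TangentSpace I x), SmoothFieldAt X p → SmoothFieldAt Y p →
    ContMDiffAt I 𝓘(ℝ, ℝ) ∞ (fun x => β x (X x) (Y x)) p

variable [FiniteDimensional ℝ E]

omit [FiniteDimensional ℝ E] in
lemma contDiffOn_of_comp_extChartAt {h : E → ℝ}
    (hh : ∀ x ∈ (extChartAt I x₀).source,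
      ContMDiffAt I 𝓘(ℝ, ℝ) ∞ (fun x => h (extChartAt I x₀ x)) x) :
    ContDiffOn ℝ ∞ h (extChartAt I x₀).target := by
  rw [← contMDiffOn_iff_contDiffOn]
  intro z hz
  have h1 := (hh _ ((extChartAt I x₀).map_target hz)).comp_contMDiffWithinAt z
    (contMDiffOn_extChartAt_symm (I := I) (n := ∞) x₀ z hz)
  refine h1.congr (fun z' hz' => ?_) ?_
  · exact congrArg h ((extChartAt I x₀).right_inv hz').symm
  · exact congrArg h ((extChartAt I x₀).right_inv hz).symm

lemma contDiffOn_oneFormInChart {α : ∀ x : N, TangentSpace I x →L[ℝ] ℝ} (hα : SmoothOneForm α) :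
    ContDiffOn ℝ ∞ (oneFormInChart α x₀) (extChartAt I x₀).target := by
  refine contDiffOn_clm_apply.2 fun u => contDiffOn_of_comp_extChartAt fun x hx => ?_
  refine (hα x _ (smoothFieldAt_coordField (x₀ := x₀) hx u)).congr_of_eventuallyEq ?_
  filter_upwards [(isOpen_extChartAt_source x₀).mem_nhds hx] with x' hx'
  exact oneFormInChart_apply α hx' u

lemma contDiffOn_twoFormInChart {β : ∀ x : N, TangentSpace I x →L[ℝ] TangentSpace I x →L[ℝ] ℝ}
    (hβ : SmoothTwoForm β) :
    ContDiffOn ℝ ∞ (twoFormInChart β x₀) (extChartAt I x₀).target := by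
  refine contDiffOn_clm_apply.2 fun u => contDiffOn_clm_apply.2 fun v =>
    contDiffOn_of_comp_extChartAt fun x hx => ?_
  refine (hβ x _ _ (smoothFieldAt_coordField (x₀ := x₀) hx u)
    (smoothFieldAt_coordField (x₀ := x₀) hx v)).congr_of_eventuallyEq ?_
  filter_upwards [(isOpen_extChartAt_source x₀).mem_nhds hx] with x' hx'
  exact twoFormInChart_apply β hx' u v

variable [I.Boundaryless]

lemma differentiableAt_oneFormInChart {α : ∀ x : N, TangentSpace I x →L[ℝ] ℝ}
    (hα : SmoothOneForm α) (hx : x ∈ (extChartAt I x₀).source) :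
    DifferentiableAt ℝ (oneFormInChart α x₀) (extChartAt I x₀ x) :=
  ((contDiffOn_oneFormInChart hα).contDiffAt ((isOpen_extChartAt_target x₀).mem_nhds
    ((extChartAt I x₀).map_source hx))).differentiableAt (by simp)

lemma differentiableAt_twoFormInChart
    {β : ∀ x : N, TangentSpace I x →L[ℝ] TangentSpace I x →L[ℝ] ℝ}
    (hβ : SmoothTwoForm β) (hx : x ∈ (extChartAt I x₀).source) :
    DifferentiableAt ℝ (twoFormInChart β x₀) (extChartAt I x₀ x) :=
  ((contDiffOn_twoFormInChart hβ).contDiffAt ((isOpen_extChartAt_target x₀).mem_nhds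
    ((extChartAt I x₀).map_source hx))).differentiableAt (by simp)

lemma extDerivOne_coordField {α : ∀ x : N, TangentSpace I x →L[ℝ] ℝ}
    (hα : SmoothOneForm α) (hx : x ∈ (extChartAt I x₀).source) (u v : E) :
    2 * extDerivOne α (coordField I x₀ u) (coordField I x₀ v) x =
      fderiv ℝ (oneFormInChart α x₀) (extChartAt I x₀ x) u v
        - fderiv ℝ (oneFormInChart α x₀) (extChartAt I x₀ x) v u := by
  have key (u v : E) : mvfderiv I (fun x => α x (coordField I x₀ v x)) x (coordField I x₀ u x) =
      fderiv ℝ (oneFormInChart α x₀) (extChartAt I x₀ x) u v := by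
    have h0 := (differentiableAt_oneFormInChart hα hx).hasFDerivAt.clm_apply
      (hasFDerivAt_const v (extChartAt I x₀ x))
    have h1 := mvfderiv_comp_extChartAt hx h0.differentiableAt u
    rw [h0.fderiv] at h1
    have h2 : (fun x => α x (coordField I x₀ v x)) =ᶠ[𝓝 x]
        fun x => oneFormInChart α x₀ (extChartAt I x₀ x) v := by
      filter_upwards [(isOpen_extChartAt_source x₀).mem_nhds hx] with x' hx'
      exact (oneFormInChart_apply α hx' v).symm
    rw [mvfderiv, h2.mfderiv_eq]
    refine Eq.trans ?_ (h1.trans (by simp))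
    rw [mvfderiv, h2.eq_of_nhds]
  rw [extDerivOne, mlieBracket_coordField hx, key, key, map_zero]
  ring

lemma extDerivTwo_coordField {β : ∀ x : N, TangentSpace I x →L[ℝ] TangentSpace I x →L[ℝ] ℝ}
    (hβ : SmoothTwoForm β) (hx : x ∈ (extChartAt I x₀).source) (u v w : E) :
    3 * extDerivTwo (fun x v w => β x v w) (coordField I x₀ u) (coordField I x₀ v)
        (coordField I x₀ w) x =
      fderiv ℝ (twoFormInChart β x₀) (extChartAt I x₀ x) u v w
        + fderiv ℝ (twoFormInChart β x₀) (extChartAt I x₀ x) v w u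
        + fderiv ℝ (twoFormInChart β x₀) (extChartAt I x₀ x) w u v := by
  have key (u v w : E) : mvfderiv I (fun x => β x (coordField I x₀ v x) (coordField I x₀ w x)) x
      (coordField I x₀ u x) =
      fderiv ℝ (twoFormInChart β x₀) (extChartAt I x₀ x) u v w := by
    have h0 := ((differentiableAt_twoFormInChart hβ hx).hasFDerivAt.clm_apply
      (hasFDerivAt_const v (extChartAt I x₀ x))).clm_apply (hasFDerivAt_const w (extChartAt I x₀ x))
    have h1 := mvfderiv_comp_extChartAt hx h0.differentiableAt u
    rw [h0.fderiv] at h1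
    have h2 : (fun x => β x (coordField I x₀ v x) (coordField I x₀ w x)) =ᶠ[𝓝 x]
        fun x => twoFormInChart β x₀ (extChartAt I x₀ x) v w := by
      filter_upwards [(isOpen_extChartAt_source x₀).mem_nhds hx] with x' hx'
      exact (twoFormInChart_apply β hx' v w).symm
    rw [mvfderiv, h2.mfderiv_eq]
    refine Eq.trans ?_ (h1.trans (by simp))
    rw [mvfderiv, h2.eq_of_nhds]
  simp only [extDerivTwo, mlieBracket_coordField hx, key, map_zero, zero_apply]
  ring

end CoordField

/-! ### Pulling back exterior derivatives to a vector space -/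

section Pullback

variable {W : Type*} [NormedAddCommGroup W] [NormedSpace ℝ W]
  {E : Type*} [NormedAddCommGroup E] [NormedSpace ℝ E]
  {H : Type*} [TopologicalSpace H] {I : ModelWithCorners ℝ E H}
  {N : Type*} [TopologicalSpace N] [ChartedSpace H N] [IsManifold I ∞ N]
  {γ : W → N} {y : W}

omit [IsManifold I ∞ N] in
lemma contDiffAt_extChartAt_comp (hγ : ContMDiffAt 𝓘(ℝ, W) I ∞ γ y) :
    ContDiffAt ℝ 2 (extChartAt I (γ y) ∘ γ) y :=
  ((contMDiffAt_iff_contDiffAt (n := ∞)).1 ((contMDiffAt_extChartAt (x := γ y)).comp y hγ)).of_le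
    two_le_infty

lemma eventually_mfderiv_eq_coordField (hγ : ContMDiffAt 𝓘(ℝ, W) I ∞ γ y) :
    ∀ᶠ y' in 𝓝 y, γ y' ∈ (extChartAt I (γ y)).source ∧ ∀ v : W, mfderiv 𝓘(ℝ, W) I γ y' v =
      coordField I (γ y) (fderiv ℝ (extChartAt I (γ y) ∘ γ) y' v) (γ y') := by
  have h1 := (contMDiffAt_iff_contMDiffAt_nhds (n := 1) (by simp)).1 (hγ.of_le (by simp))
  have h2 := hγ.continuousAt.preimage_mem_nhds
    ((isOpen_extChartAt_source (I := I) (γ y)).mem_nhds (mem_extChartAt_source (γ y)))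
  filter_upwards [h1, h2] with y' hy hs
  refine ⟨hs, fun v => ?_⟩
  have he : MDifferentiableAt I 𝓘(ℝ, E) (extChartAt I (γ y)) (γ y') :=
    (contMDiffAt_extChartAt' (n := 1) (by simpa using hs)).mdifferentiableAt (by simp)
  have h3 := mfderiv_comp_apply y' he (hy.mdifferentiableAt (by simp)) v
  rw [mfderiv_eq_fderiv] at h3
  rw [← coordField_mfderiv_extChartAt hs (mfderiv 𝓘(ℝ, W) I γ y' v)]
  exact congrArg (fun e => coordField I (γ y) e (γ y')) h3.symm

variable [FiniteDimensional ℝ E] [I.Boundaryless]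

lemma differentiableAt_pullback_oneForm {α : ∀ x : N, TangentSpace I x →L[ℝ] ℝ}
    (hα : SmoothOneForm α) (hγ : ContMDiffAt 𝓘(ℝ, W) I ∞ γ y) (v : W) :
    DifferentiableAt ℝ (fun y => α (γ y) (mfderiv 𝓘(ℝ, W) I γ y v)) y := by
  refine (hasFDerivAt_pullback (G := extChartAt I (γ y) ∘ γ)
    (differentiableAt_oneFormInChart hα (mem_extChartAt_source (γ y)))
    (contDiffAt_extChartAt_comp hγ) v).differentiableAt.congr_of_eventuallyEq ?_
  filter_upwards [eventually_mfderiv_eq_coordField hγ] with y' hy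
  rw [hy.2 v]
  exact (oneFormInChart_apply α hy.1 _).symm

lemma fderiv_pullback_oneForm_eq {α : ∀ x : N, TangentSpace I x →L[ℝ] ℝ}
    (hα : SmoothOneForm α) (hγ : ContMDiffAt 𝓘(ℝ, W) I ∞ γ y) (u v : W) :
    fderiv ℝ (fun y => α (γ y) (mfderiv 𝓘(ℝ, W) I γ y v)) y u =
      fderiv ℝ (oneFormInChart α (γ y)) (extChartAt I (γ y) (γ y))
          (fderiv ℝ (extChartAt I (γ y) ∘ γ) y u) (fderiv ℝ (extChartAt I (γ y) ∘ γ) y v)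
        + oneFormInChart α (γ y) (extChartAt I (γ y) (γ y))
          (fderiv ℝ (fderiv ℝ (extChartAt I (γ y) ∘ γ)) y u v) := by
  rw [← Function.comp_apply (f := extChartAt I (γ y)) (g := γ),
    ← fderiv_pullback_oneForm (G := extChartAt I (γ y) ∘ γ)
    (differentiableAt_oneFormInChart hα (mem_extChartAt_source (γ y)))
    (contDiffAt_extChartAt_comp hγ)]
  refine DFunLike.congr_fun (Filter.EventuallyEq.fderiv_eq (𝕜 := ℝ) ?_) u
  filter_upwards [eventually_mfderiv_eq_coordField hγ] with y' hy
  rw [hy.2 v]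
  exact (oneFormInChart_apply α hy.1 _).symm

/-- Naturality of the exterior derivative of a 1-form under pullback to a vector space. -/
lemma exists_extDerivOne_eq_pullback {α : ∀ x : N, TangentSpace I x →L[ℝ] ℝ}
    (hα : SmoothOneForm α) (hγ : ContMDiffAt 𝓘(ℝ, W) I ∞ γ y) (u v : W) :
    ∃ X Y : ∀ x : N, TangentSpace I x, SmoothFieldAt X (γ y) ∧ SmoothFieldAt Y (γ y) ∧
      X (γ y) = mfderiv 𝓘(ℝ, W) I γ y u ∧ Y (γ y) = mfderiv 𝓘(ℝ, W) I γ y v ∧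
      2 * extDerivOne α X Y (γ y) =
        fderiv ℝ (fun y => α (γ y) (mfderiv 𝓘(ℝ, W) I γ y v)) y u
          - fderiv ℝ (fun y => α (γ y) (mfderiv 𝓘(ℝ, W) I γ y u)) y v := by
  have hs := mem_extChartAt_source (I := I) (γ y)
  have hc := (eventually_mfderiv_eq_coordField hγ).self_of_nhds.2
  refine ⟨_, _, smoothFieldAt_coordField hs _, smoothFieldAt_coordField hs _, (hc u).symm,
    (hc v).symm, ?_⟩
  rw [extDerivOne_coordField hα hs, fderiv_pullback_oneForm_eq hα hγ,
    fderiv_pullback_oneForm_eq hα hγ,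
    ((contDiffAt_extChartAt_comp hγ).isSymmSndFDerivAt (by simp)).eq u v]
  ring

lemma differentiableAt_pullback_twoForm
    {β : ∀ x : N, TangentSpace I x →L[ℝ] TangentSpace I x →L[ℝ] ℝ}
    (hβ : SmoothTwoForm β) (hγ : ContMDiffAt 𝓘(ℝ, W) I ∞ γ y) (v w : W) :
    DifferentiableAt ℝ
      (fun y => β (γ y) (mfderiv 𝓘(ℝ, W) I γ y v) (mfderiv 𝓘(ℝ, W) I γ y w)) y := by
  have hG := contDiffAt_extChartAt_comp hγ
  have h1 := (hG.fderiv_right (m := 1) (by norm_num)).differentiableAt (by norm_num)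
  refine ((hasFDerivAt_pullback (G := extChartAt I (γ y) ∘ γ)
    (differentiableAt_twoFormInChart hβ (mem_extChartAt_source (γ y)))
    hG v).differentiableAt.clm_apply
    (h1.clm_apply (differentiableAt_const w))).congr_of_eventuallyEq ?_
  filter_upwards [eventually_mfderiv_eq_coordField hγ] with y' hy
  rw [hy.2 v, hy.2 w]
  exact (twoFormInChart_apply β hy.1 _ _).symm

lemma fderiv_pullback_twoForm_eq
    {β : ∀ x : N, TangentSpace I x →L[ℝ] TangentSpace I x →L[ℝ] ℝ}
    (hβ : SmoothTwoForm β) (hγ : ContMDiffAt 𝓘(ℝ, W) I ∞ γ y) (u v w : W) :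
    fderiv ℝ (fun y => β (γ y) (mfderiv 𝓘(ℝ, W) I γ y v) (mfderiv 𝓘(ℝ, W) I γ y w)) y u =
      fderiv ℝ (twoFormInChart β (γ y)) (extChartAt I (γ y) (γ y))
          (fderiv ℝ (extChartAt I (γ y) ∘ γ) y u) (fderiv ℝ (extChartAt I (γ y) ∘ γ) y v)
          (fderiv ℝ (extChartAt I (γ y) ∘ γ) y w)
        + twoFormInChart β (γ y) (extChartAt I (γ y) (γ y))
          (fderiv ℝ (fderiv ℝ (extChartAt I (γ y) ∘ γ)) y u v)
          (fderiv ℝ (extChartAt I (γ y) ∘ γ) y w)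
        + twoFormInChart β (γ y) (extChartAt I (γ y) (γ y))
          (fderiv ℝ (extChartAt I (γ y) ∘ γ) y v)
          (fderiv ℝ (fderiv ℝ (extChartAt I (γ y) ∘ γ)) y u w) := by
  rw [← Function.comp_apply (f := extChartAt I (γ y)) (g := γ),
    ← fderiv_pullback_twoForm (G := extChartAt I (γ y) ∘ γ)
    (differentiableAt_twoFormInChart hβ (mem_extChartAt_source (γ y)))
    (contDiffAt_extChartAt_comp hγ)]
  refine DFunLike.congr_fun (Filter.EventuallyEq.fderiv_eq (𝕜 := ℝ) ?_) u
  filter_upwards [eventually_mfderiv_eq_coordField hγ] with y' hy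
  rw [hy.2 v, hy.2 w]
  exact (twoFormInChart_apply β hy.1 _ _).symm

/-- Naturality of the exterior derivative of a 2-form under pullback to a vector space. -/
lemma exists_extDerivTwo_eq_pullback
    {β : ∀ x : N, TangentSpace I x →L[ℝ] TangentSpace I x →L[ℝ] ℝ}
    (hβ : SmoothTwoForm β) (hβ' : ∀ x v w, β x v w = - β x w v)
    (hγ : ContMDiffAt 𝓘(ℝ, W) I ∞ γ y) (u v w : W) :
    ∃ X Y Z : ∀ x : N, TangentSpace I x,
      SmoothFieldAt X (γ y) ∧ SmoothFieldAt Y (γ y) ∧ SmoothFieldAt Z (γ y) ∧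
      X (γ y) = mfderiv 𝓘(ℝ, W) I γ y u ∧ Y (γ y) = mfderiv 𝓘(ℝ, W) I γ y v ∧
      Z (γ y) = mfderiv 𝓘(ℝ, W) I γ y w ∧
      3 * extDerivTwo (fun x v w => β x v w) X Y Z (γ y) =
        fderiv ℝ (fun y => β (γ y) (mfderiv 𝓘(ℝ, W) I γ y v) (mfderiv 𝓘(ℝ, W) I γ y w)) y u
        + fderiv ℝ (fun y => β (γ y) (mfderiv 𝓘(ℝ, W) I γ y w) (mfderiv 𝓘(ℝ, W) I γ y u)) y v
        + fderiv ℝ (fun y => β (γ y) (mfderiv 𝓘(ℝ, W) I γ y u) (mfderiv 𝓘(ℝ, W) I γ y v)) y w := by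
  have hs := mem_extChartAt_source (I := I) (γ y)
  have hc := (eventually_mfderiv_eq_coordField hγ).self_of_nhds.2
  have hsymm := (contDiffAt_extChartAt_comp hγ).isSymmSndFDerivAt (by simp)
  have hanti (a b : E) : twoFormInChart β (γ y) (extChartAt I (γ y) (γ y)) a b =
      - twoFormInChart β (γ y) (extChartAt I (γ y) (γ y)) b a := by
    rw [twoFormInChart_apply β hs, twoFormInChart_apply β hs, hβ']
  refine ⟨_, _, _, smoothFieldAt_coordField hs _, smoothFieldAt_coordField hs _,
    smoothFieldAt_coordField hs _, (hc u).symm, (hc v).symm, (hc w).symm, ?_⟩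
  rw [extDerivTwo_coordField hβ hs, fderiv_pullback_twoForm_eq hβ hγ,
    fderiv_pullback_twoForm_eq hβ hγ, fderiv_pullback_twoForm_eq hβ hγ,
    hsymm.eq u v, hsymm.eq v w, hsymm.eq w u,
    hanti (fderiv ℝ (extChartAt I (γ y) ∘ γ) y u), hanti (fderiv ℝ (extChartAt I (γ y) ∘ γ) y v),
    hanti (fderiv ℝ (extChartAt I (γ y) ∘ γ) y w)]
  ring

end Pullback

/-! ### Forms on a product which are constant along the first factor -/

section Product

variable {E : Type*} [NormedAddCommGroup E] [NormedSpace ℝ E] [FiniteDimensional ℝ E]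
  {H : Type*} [TopologicalSpace H] {I : ModelWithCorners ℝ E H} [I.Boundaryless]
  {N : Type*} [TopologicalSpace N] [ChartedSpace H N] [IsManifold I ∞ N]
  {E₁ : Type*} [NormedAddCommGroup E₁] [NormedSpace ℝ E₁]
  {H₁ : Type*} [TopologicalSpace H₁] {I₁ : ModelWithCorners ℝ E₁ H₁} [I₁.Boundaryless]
  {B : Type*} [TopologicalSpace B] [ChartedSpace H₁ B] [IsManifold I₁ ∞ B]
  {E₂ : Type*} [NormedAddCommGroup E₂] [NormedSpace ℝ E₂]
  {H₂ : Type*} [TopologicalSpace H₂] {I₂ : ModelWithCorners ℝ E₂ H₂} [I₂.Boundaryless]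
  {F : Type*} [TopologicalSpace F] [ChartedSpace H₂ F] [IsManifold I₂ ∞ F]
  {ι : B × F → N}

omit [IsManifold I₁ ∞ B] in
lemma eq_of_fderiv_eq_zero_in_charts [PreconnectedSpace B] {h : B → ℝ}
    (hh : ∀ b₀ : B, ∃ g : E₁ → ℝ, (∀ b ∈ (extChartAt I₁ b₀).source, h b = g (extChartAt I₁ b₀ b)) ∧
      ∀ y ∈ (extChartAt I₁ b₀).target, DifferentiableAt ℝ g y ∧ fderiv ℝ g y = 0) (b b' : B) :
    h b = h b' := by
  refine IsLocallyConstant.apply_eq_of_preconnectedSpace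
    ((IsLocallyConstant.iff_eventually_eq _).2 fun b₀ => ?_) b b'
  obtain ⟨g, hg, hg'⟩ := hh b₀
  obtain ⟨r, hr, hball⟩ := Metric.isOpen_iff.1 (isOpen_extChartAt_target (I := I₁) b₀) _
    (mem_extChartAt_target b₀)
  filter_upwards [(isOpen_extChartAt_source (I := I₁) b₀).mem_nhds (mem_extChartAt_source b₀),
    (continuousAt_extChartAt (I := I₁) b₀).preimage_mem_nhds (Metric.ball_mem_nhds _ hr)]
    with b hb hb'
  rw [hg b hb, hg b₀ (mem_extChartAt_source b₀)]
  exact Metric.isOpen_ball.is_const_of_fderiv_eq_zero (convex_ball _ _).isPreconnected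
    (fun y hy => (hg' y (hball hy)).1.differentiableWithinAt) (fun y hy => (hg' y (hball hy)).2)
    hb' (Metric.mem_ball_self hr)

/-- A map defined on a product manifold, in coordinates on the product. -/
def inProductChart (I₁ : ModelWithCorners ℝ E₁ H₁) (I₂ : ModelWithCorners ℝ E₂ H₂)
    (ι : B × F → N) (b₀ : B) (q₀ : F) (y : E₁ × E₂) : N :=
  ι ((extChartAt I₁ b₀).symm y.1, (extChartAt I₂ q₀).symm y.2)

omit [FiniteDimensional ℝ E] [I.Boundaryless] [IsManifold I ∞ N] in
lemma contMDiffAt_inProductChart (hι : ContMDiff (I₁.prod I₂) I ∞ ι) {b₀ : B} {q₀ : F}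
    {y : E₁ × E₂} (h₁ : y.1 ∈ (extChartAt I₁ b₀).target) (h₂ : y.2 ∈ (extChartAt I₂ q₀).target) :
    ContMDiffAt 𝓘(ℝ, E₁ × E₂) I ∞ (inProductChart I₁ I₂ ι b₀ q₀) y := by
  have e₁ := (contMDiffOn_extChartAt_symm (I := I₁) (n := ∞) b₀).contMDiffAt
    ((isOpen_extChartAt_target b₀).mem_nhds h₁)
  have e₂ := (contMDiffOn_extChartAt_symm (I := I₂) (n := ∞) q₀).contMDiffAt
    ((isOpen_extChartAt_target q₀).mem_nhds h₂)
  have e₁' := e₁.comp y (contMDiffAt_iff_contDiffAt.2 contDiffAt_fst)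
  have e₂' := e₂.comp y (contMDiffAt_iff_contDiffAt.2 contDiffAt_snd)
  exact hι.contMDiffAt.comp y (e₁'.prodMk e₂')

omit [FiniteDimensional ℝ E] [I.Boundaryless] [IsManifold I ∞ N] in
lemma mfderiv_inProductChart (hι : ContMDiff (I₁.prod I₂) I ∞ ι) {b₀ : B} {q₀ : F}
    {y : E₁ × E₂} (h₁ : y.1 ∈ (extChartAt I₁ b₀).target) (h₂ : y.2 ∈ (extChartAt I₂ q₀).target)
    (v : E₁ × E₂) :
    mfderiv 𝓘(ℝ, E₁ × E₂) I (inProductChart I₁ I₂ ι b₀ q₀) y v =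
      mfderiv (I₁.prod I₂) I ι ((extChartAt I₁ b₀).symm y.1, (extChartAt I₂ q₀).symm y.2)
        (mfderiv 𝓘(ℝ, E₁) I₁ (extChartAt I₁ b₀).symm y.1 v.1,
          mfderiv 𝓘(ℝ, E₂) I₂ (extChartAt I₂ q₀).symm y.2 v.2) := by
  have e₁ := ((contMDiffOn_extChartAt_symm (I := I₁) (n := ∞) b₀).contMDiffAt
    ((isOpen_extChartAt_target b₀).mem_nhds h₁)).mdifferentiableAt (by simp)
  have e₂ := ((contMDiffOn_extChartAt_symm (I := I₂) (n := ∞) q₀).contMDiffAt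
    ((isOpen_extChartAt_target q₀).mem_nhds h₂)).mdifferentiableAt (by simp)
  have hm := hι.mdifferentiableAt (by simp)
    (x := ((extChartAt I₁ b₀).symm y.1, (extChartAt I₂ q₀).symm y.2))
  have hp := e₁.prodMap e₂
  have h := mfderiv_comp_apply y hm hp v
  rw [mfderiv_prodMap e₁ e₂] at h
  rw [modelWithCornersSelf_prod, ← chartedSpaceSelf_prod]
  exact h

omit [FiniteDimensional ℝ E] [I.Boundaryless] [IsManifold I ∞ N] in
lemma mfderiv_inProductChart_base (hι : ContMDiff (I₁.prod I₂) I ∞ ι) {b₀ : B} {q₀ : F}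
    {y : E₁ × E₂} (h₁ : y.1 ∈ (extChartAt I₁ b₀).target) (h₂ : y.2 ∈ (extChartAt I₂ q₀).target)
    (u : E₁) :
    mfderiv 𝓘(ℝ, E₁ × E₂) I (inProductChart I₁ I₂ ι b₀ q₀) y (u, (0 : E₂)) =
      mfderiv (I₁.prod I₂) I ι ((extChartAt I₁ b₀).symm y.1, (extChartAt I₂ q₀).symm y.2)
        (mfderiv 𝓘(ℝ, E₁) I₁ (extChartAt I₁ b₀).symm y.1 u, (0 : E₂)) :=
  (mfderiv_inProductChart hι h₁ h₂ _).trans (congrArg _ (Prod.ext rfl (map_zero _)))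

omit [FiniteDimensional ℝ E] [I.Boundaryless] [IsManifold I ∞ N] in
lemma mfderiv_inProductChart_fiber (hι : ContMDiff (I₁.prod I₂) I ∞ ι) {b₀ : B} {q₀ : F}
    {y : E₁ × E₂} (h₁ : y.1 ∈ (extChartAt I₁ b₀).target) (h₂ : y.2 ∈ (extChartAt I₂ q₀).target)
    (v : E₂) :
    mfderiv 𝓘(ℝ, E₁ × E₂) I (inProductChart I₁ I₂ ι b₀ q₀) y ((0 : E₁), v) =
      mfderiv (I₁.prod I₂) I ι ((extChartAt I₁ b₀).symm y.1, (extChartAt I₂ q₀).symm y.2)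
        ((0 : E₁), mfderiv 𝓘(ℝ, E₂) I₂ (extChartAt I₂ q₀).symm y.2 v) :=
  (mfderiv_inProductChart hι h₁ h₂ _).trans (congrArg _ (Prod.ext (map_zero _) rfl))

lemma mfderiv_extChartAt_symm_apply_self {q : F} (z : TangentSpace I₂ q) :
    mfderiv 𝓘(ℝ, E₂) I₂ (extChartAt I₂ q).symm (extChartAt I₂ q q)
      (mfderiv I₂ 𝓘(ℝ, E₂) (extChartAt I₂ q) q z) = z := by
  have h := mfderivWithin_extChartAt_symm_comp_mfderiv_extChartAt' (I := I₂) (x := q)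
    (mem_extChartAt_source (I := I₂) q)
  rw [I₂.range_eq_univ, mfderivWithin_univ] at h
  exact DFunLike.congr_fun h z

/-- If the pullback to `B × F` of a 1-form on `N` vanishes on `TB`, and its exterior derivative
vanishes on `TB × TF`, then its restriction to `TF` is constant along `B`. -/
lemma oneForm_constant_along_base [PreconnectedSpace B] {α : ∀ x : N, TangentSpace I x →L[ℝ] ℝ}
    (hα : SmoothOneForm α) (hι : ContMDiff (I₁.prod I₂) I ∞ ι)
    (hbase : ∀ (p : B × F) (x : E₁), α (ι p) (mfderiv (I₁.prod I₂) I ι p (x, (0 : E₂))) = 0)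
    (hd : ∀ (p : B × F) (x : E₁) (z : E₂) (X Y : ∀ x : N, TangentSpace I x),
      SmoothFieldAt X (ι p) → SmoothFieldAt Y (ι p) →
      X (ι p) = mfderiv (I₁.prod I₂) I ι p (x, (0 : E₂)) →
      Y (ι p) = mfderiv (I₁.prod I₂) I ι p ((0 : E₁), z) → extDerivOne α X Y (ι p) = 0)
    (q : F) (z : E₂) (b b' : B) :
    α (ι (b, q)) (mfderiv (I₁.prod I₂) I ι (b, q) ((0 : E₁), z)) =
      α (ι (b', q)) (mfderiv (I₁.prod I₂) I ι (b', q) ((0 : E₁), z)) := by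
  refine eq_of_fderiv_eq_zero_in_charts (I₁ := I₁)
    (h := fun b => α (ι (b, q)) (mfderiv (I₁.prod I₂) I ι (b, q) ((0 : E₁), z)))
    (fun b₀ => ?_) b b'
  set γ := inProductChart I₁ I₂ ι b₀ q with hγ
  set c := extChartAt I₂ q q with hc
  have hct : c ∈ (extChartAt I₂ q).target := mem_extChartAt_target q
  have hcq : (extChartAt I₂ q).symm c = q := extChartAt_to_inv q
  set v : E₂ := mfderiv I₂ 𝓘(ℝ, E₂) (extChartAt I₂ q) q z with hv
  have hvz : mfderiv 𝓘(ℝ, E₂) I₂ (extChartAt I₂ q).symm c v = z :=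
    mfderiv_extChartAt_symm_apply_self z
  set a : E₁ × E₂ → E₁ × E₂ → ℝ := fun y u => α (γ y) (mfderiv 𝓘(ℝ, E₁ × E₂) I γ y u) with ha
  refine ⟨fun y => a (y, c) (0, v), fun b hb => ?_, fun y hy => ?_⟩
  · have h1 := mfderiv_inProductChart_fiber hι (b₀ := b₀) (q₀ := q) (y := (extChartAt I₁ b₀ b, c))
      ((extChartAt I₁ b₀).map_source hb) hct v
    have hp : ((extChartAt I₁ b₀).symm (extChartAt I₁ b₀ b), (extChartAt I₂ q).symm c) = (b, q) :=
      Prod.ext ((extChartAt I₁ b₀).left_inv hb) hcq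
    have h2 := congrArg
      (fun p : B × F => α (ι p) (mfderiv (I₁.prod I₂) I ι p ((0 : E₁), z))) hp
    refine h2.symm.trans ?_
    simp only [ha]
    rw [h1]
    simp only [hvz]
    rfl
  · have hsm := contMDiffAt_inProductChart hι (b₀ := b₀) (q₀ := q) (y := (y, c)) hy hct
    have hdiff : DifferentiableAt ℝ (fun y' => a y' (0, v)) (y, c) :=
      differentiableAt_pullback_oneForm hα hsm (0, v)
    have hcomp := HasFDerivAt.comp (f := fun y => (y, c)) y hdiff.hasFDerivAt
      ((hasFDerivAt_id y).prodMk (hasFDerivAt_const c y))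
    refine ⟨hcomp.differentiableAt, ?_⟩
    ext u
    have h0 : fderiv ℝ (fun y' => a y' (u, 0)) (y, c) = 0 := by
      have : (fun y' => a y' (u, 0)) =ᶠ[𝓝 (y, c)] fun _ => 0 := by
        filter_upwards [((isOpen_extChartAt_target (I := I₁) b₀).prod
          (isOpen_extChartAt_target (I := I₂) q)).mem_nhds ⟨hy, hct⟩] with y' hy'
        exact (congrArg _ (mfderiv_inProductChart_base hι hy'.1 hy'.2 u)).trans (hbase _ _)
      rw [this.fderiv_eq]
      simp
    obtain ⟨X, Y, hX, hY, hXu, hYv, hXY⟩ := exists_extDerivOne_eq_pullback hα hsm (u, 0) (0, v)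
    have hz := hd _ _ _ X Y hX hY (hXu.trans (mfderiv_inProductChart_base hι hy hct u))
      (hYv.trans (mfderiv_inProductChart_fiber hι hy hct v))
    change 2 * extDerivOne α X Y (γ (y, c)) = fderiv ℝ (fun y' => a y' (0, v)) (y, c) (u, 0)
      - fderiv ℝ (fun y' => a y' (u, 0)) (y, c) (0, v) at hXY
    change extDerivOne α X Y (γ (y, c)) = 0 at hz
    rw [hz, h0] at hXY
    have := hcomp.fderiv
    change fderiv ℝ (fun y => a (y, c) (0, v)) y = _ at this
    rw [this]
    simpa using hXY.symm

/-- If the pullback to `B × F` of a 2-form on `N` vanishes on `TB × TF`, and its exterior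
derivative vanishes on `TB × TF × TF`, then its restriction to `TF` is constant along `B`. -/
lemma twoForm_constant_along_base [PreconnectedSpace B]
    {β : ∀ x : N, TangentSpace I x →L[ℝ] TangentSpace I x →L[ℝ] ℝ}
    (hβ : SmoothTwoForm β) (hβ' : ∀ x v w, β x v w = - β x w v)
    (hι : ContMDiff (I₁.prod I₂) I ∞ ι)
    (hmix : ∀ (p : B × F) (x : E₁) (z : E₂), β (ι p) (mfderiv (I₁.prod I₂) I ι p (x, (0 : E₂)))
      (mfderiv (I₁.prod I₂) I ι p ((0 : E₁), z)) = 0)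
    (hd : ∀ (p : B × F) (x : E₁) (z w : E₂) (X Y Z : ∀ x : N, TangentSpace I x),
      SmoothFieldAt X (ι p) → SmoothFieldAt Y (ι p) → SmoothFieldAt Z (ι p) →
      X (ι p) = mfderiv (I₁.prod I₂) I ι p (x, (0 : E₂)) →
      Y (ι p) = mfderiv (I₁.prod I₂) I ι p ((0 : E₁), z) →
      Z (ι p) = mfderiv (I₁.prod I₂) I ι p ((0 : E₁), w) →
      extDerivTwo (fun x v w => β x v w) X Y Z (ι p) = 0)
    (q : F) (z w : E₂) (b b' : B) :
    β (ι (b, q)) (mfderiv (I₁.prod I₂) I ι (b, q) ((0 : E₁), z))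
        (mfderiv (I₁.prod I₂) I ι (b, q) ((0 : E₁), w)) =
      β (ι (b', q)) (mfderiv (I₁.prod I₂) I ι (b', q) ((0 : E₁), z))
        (mfderiv (I₁.prod I₂) I ι (b', q) ((0 : E₁), w)) := by
  refine eq_of_fderiv_eq_zero_in_charts (I₁ := I₁)
    (h := fun b => β (ι (b, q)) (mfderiv (I₁.prod I₂) I ι (b, q) ((0 : E₁), z))
      (mfderiv (I₁.prod I₂) I ι (b, q) ((0 : E₁), w)))
    (fun b₀ => ?_) b b'
  set γ := inProductChart I₁ I₂ ι b₀ q with hγ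
  set c := extChartAt I₂ q q with hc
  have hct : c ∈ (extChartAt I₂ q).target := mem_extChartAt_target q
  have hcq : (extChartAt I₂ q).symm c = q := extChartAt_to_inv q
  set v : E₂ := mfderiv I₂ 𝓘(ℝ, E₂) (extChartAt I₂ q) q z with hv
  have hvz : mfderiv 𝓘(ℝ, E₂) I₂ (extChartAt I₂ q).symm c v = z :=
    mfderiv_extChartAt_symm_apply_self z
  set v' : E₂ := mfderiv I₂ 𝓘(ℝ, E₂) (extChartAt I₂ q) q w with hv'
  have hvw : mfderiv 𝓘(ℝ, E₂) I₂ (extChartAt I₂ q).symm c v' = w :=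
    mfderiv_extChartAt_symm_apply_self w
  set a : E₁ × E₂ → E₁ × E₂ → E₁ × E₂ → ℝ := fun y u u' =>
    β (γ y) (mfderiv 𝓘(ℝ, E₁ × E₂) I γ y u) (mfderiv 𝓘(ℝ, E₁ × E₂) I γ y u') with ha
  refine ⟨fun y => a (y, c) (0, v) (0, v'), fun b hb => ?_, fun y hy => ?_⟩
  · have h1 (v) := mfderiv_inProductChart_fiber hι (b₀ := b₀) (q₀ := q)
      (y := (extChartAt I₁ b₀ b, c)) ((extChartAt I₁ b₀).map_source hb) hct v
    have hp : ((extChartAt I₁ b₀).symm (extChartAt I₁ b₀ b), (extChartAt I₂ q).symm c) = (b, q) :=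
      Prod.ext ((extChartAt I₁ b₀).left_inv hb) hcq
    have h2 := congrArg
      (fun p : B × F => β (ι p) (mfderiv (I₁.prod I₂) I ι p ((0 : E₁), z))
        (mfderiv (I₁.prod I₂) I ι p ((0 : E₁), w))) hp
    refine h2.symm.trans ?_
    simp only [ha]
    rw [h1, h1]
    simp only [hvz, hvw]
    rfl
  · have hsm := contMDiffAt_inProductChart hι (b₀ := b₀) (q₀ := q) (y := (y, c)) hy hct
    have hdiff : DifferentiableAt ℝ (fun y' => a y' (0, v) (0, v')) (y, c) :=
      differentiableAt_pullback_twoForm hβ hsm (0, v) (0, v')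
    have hcomp := HasFDerivAt.comp (f := fun y => (y, c)) y hdiff.hasFDerivAt
      ((hasFDerivAt_id y).prodMk (hasFDerivAt_const c y))
    refine ⟨hcomp.differentiableAt, ?_⟩
    ext u
    have h0 (v : E₂) : (fun y' => a y' (u, 0) (0, v)) =ᶠ[𝓝 (y, c)] fun _ => 0 := by
      filter_upwards [((isOpen_extChartAt_target (I := I₁) b₀).prod
        (isOpen_extChartAt_target (I := I₂) q)).mem_nhds ⟨hy, hct⟩] with y' hy'
      exact (congrArg₂ (fun v w => β (γ y') v w) (mfderiv_inProductChart_base hι hy'.1 hy'.2 u)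
        (mfderiv_inProductChart_fiber hι hy'.1 hy'.2 v)).trans (hmix _ _ _)
    have h0' (v : E₂) : (fun y' => a y' (0, v) (u, 0)) =ᶠ[𝓝 (y, c)] fun _ => 0 := by
      filter_upwards [h0 v] with y' hy'
      exact (hβ' _ _ _).trans (neg_eq_zero.2 hy')
    obtain ⟨X, Y, Z, hX, hY, hZ, hXu, hYv, hZv, hXYZ⟩ :=
      exists_extDerivTwo_eq_pullback hβ hβ' hsm (u, 0) (0, v) (0, v')
    have hz := hd _ _ _ _ X Y Z hX hY hZ (hXu.trans (mfderiv_inProductChart_base hι hy hct u))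
      (hYv.trans (mfderiv_inProductChart_fiber hι hy hct v))
      (hZv.trans (mfderiv_inProductChart_fiber hι hy hct v'))
    change 3 * extDerivTwo (fun x v w => β x v w) X Y Z (γ (y, c)) =
      fderiv ℝ (fun y' => a y' (0, v) (0, v')) (y, c) (u, 0)
      + fderiv ℝ (fun y' => a y' (0, v') (u, 0)) (y, c) (0, v)
      + fderiv ℝ (fun y' => a y' (u, 0) (0, v)) (y, c) (0, v') at hXYZ
    change extDerivTwo (fun x v w => β x v w) X Y Z (γ (y, c)) = 0 at hz
    rw [hz, (h0 v).fderiv_eq, (h0' v').fderiv_eq] at hXYZ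
    have := hcomp.fderiv
    change fderiv ℝ (fun y => a (y, c) (0, v) (0, v')) y = _ at this
    rw [this]
    simpa using hXYZ.symm

/-- If the pullback to `B × F` of a 1-form on `N` vanishes, then so does the pullback of its
exterior derivative. -/
lemma exists_extDerivOne_eq_zero {α : ∀ x : N, TangentSpace I x →L[ℝ] ℝ}
    (hα : SmoothOneForm α) (hι : ContMDiff (I₁.prod I₂) I ∞ ι)
    (h0 : ∀ (p : B × F) (v : E₁ × E₂), α (ι p) (mfderiv (I₁.prod I₂) I ι p v) = 0)
    (p : B × F) (z w : E₂) :
    ∃ X Y : ∀ x : N, TangentSpace I x, SmoothFieldAt X (ι p) ∧ SmoothFieldAt Y (ι p) ∧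
      X (ι p) = mfderiv (I₁.prod I₂) I ι p ((0 : E₁), z) ∧
      Y (ι p) = mfderiv (I₁.prod I₂) I ι p ((0 : E₁), w) ∧ extDerivOne α X Y (ι p) = 0 := by
  obtain ⟨b, q⟩ := p
  have hb := mem_extChartAt_target (I := I₁) b
  have hq := mem_extChartAt_target (I := I₂) q
  have hp : ((extChartAt I₁ b).symm (extChartAt I₁ b b), (extChartAt I₂ q).symm (extChartAt I₂ q q))
      = (b, q) := Prod.ext (extChartAt_to_inv b) (extChartAt_to_inv q)
  set y : E₁ × E₂ := (extChartAt I₁ b b, extChartAt I₂ q q)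
  have hsm := contMDiffAt_inProductChart hι (b₀ := b) (q₀ := q) (y := y) hb hq
  have hz (u : E₁ × E₂) : (fun y => α (inProductChart I₁ I₂ ι b q y)
      (mfderiv 𝓘(ℝ, E₁ × E₂) I (inProductChart I₁ I₂ ι b q) y u)) =ᶠ[𝓝 y] fun _ => 0 := by
    filter_upwards [((isOpen_extChartAt_target (I := I₁) b).prod
      (isOpen_extChartAt_target (I := I₂) q)).mem_nhds ⟨hb, hq⟩] with y' hy'
    exact (congrArg _ (mfderiv_inProductChart hι hy'.1 hy'.2 u)).trans (h0 _ _)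
  obtain ⟨X, Y, hX, hY, hXz, hYw, hXY⟩ := exists_extDerivOne_eq_pullback hα hsm
    (0, (mfderiv I₂ 𝓘(ℝ, E₂) (extChartAt I₂ q) q z : E₂))
    (0, (mfderiv I₂ 𝓘(ℝ, E₂) (extChartAt I₂ q) q w : E₂))
  rw [(hz _).fderiv_eq, (hz _).fderiv_eq] at hXY
  rw [← hp]
  have key (z : E₂) := (mfderiv_inProductChart_fiber hι (b₀ := b) (q₀ := q) (y := y) hb hq
    (mfderiv I₂ 𝓘(ℝ, E₂) (extChartAt I₂ q) q z)).trans
    (congrArg (fun z : E₂ => mfderiv (I₁.prod I₂) I ι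
      ((extChartAt I₁ b).symm y.1, (extChartAt I₂ q).symm y.2) ((0 : E₁), z))
      (mfderiv_extChartAt_symm_apply_self (I₂ := I₂) (q := q) z))
  refine ⟨X, Y, hX, hY, hXz.trans (key z), hYw.trans (key w), ?_⟩
  have : 2 * extDerivOne α X Y (inProductChart I₁ I₂ ι b q y) = 0 := by simpa using hXY
  exact (mul_eq_zero.1 this).resolve_left two_ne_zero

end Product

/-! ### Almost contact metric structures -/

namespace AlmostContactMetric

variable {E : Type*} [NormedAddCommGroup E] [NormedSpace ℝ E]
  {H : Type*} [TopologicalSpace H] {I : ModelWithCorners ℝ E H}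
  {N : Type*} [TopologicalSpace N] [ChartedSpace H N] [IsManifold I ∞ N]
  [RiemannianBundle (fun x : N => TangentSpace I x)]
  (S : AlmostContactMetric I N)

lemma φ_ξ (x : N) : S.φ x (S.ξ x) = 0 := by
  have h1 : S.φ x (S.φ x (S.ξ x)) = 0 := by rw [S.φ_φ, S.η_ξ, one_smul, neg_add_cancel]
  have h2 := S.φ_φ x (S.φ x (S.ξ x))
  rw [h1, map_zero] at h2
  have h3 : S.φ x (S.ξ x) = S.η x (S.φ x (S.ξ x)) • S.ξ x := by
    rw [← sub_eq_zero, ← neg_eq_zero, h2]; abel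
  set a := S.η x (S.φ x (S.ξ x))
  have h4 : (a * a) • S.ξ x = 0 := by
    rw [mul_smul, ← h3, ← map_smul, ← h3, h1]
  have h5 := congrArg (S.η x) h4
  rw [map_smul, S.η_ξ, map_zero, smul_eq_mul, mul_one, mul_self_eq_zero] at h5
  rw [h3, h5, zero_smul]

lemma η_φ (x : N) (v : TangentSpace I x) : S.η x (S.φ x v) = 0 := by
  have h1 := congrArg (S.φ x) (S.φ_φ x v)
  rw [S.φ_φ, map_add, map_neg, map_smul, S.φ_ξ, smul_zero] at h1
  have h2 : S.η x (S.φ x v) • S.ξ x = 0 := by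
    exact add_left_cancel h1
  have h3 := congrArg (S.η x) h2
  rwa [map_smul, S.η_ξ, map_zero, smul_eq_mul, mul_one] at h3

lemma inner_ξ (x : N) (v : TangentSpace I x) : ⟪v, S.ξ x⟫_ℝ = S.η x v := by
  have h := S.inner_φ_φ x v (S.ξ x)
  rw [S.φ_ξ, inner_zero_right, S.η_ξ, mul_one] at h
  linarith

lemma inner_φ_left (x : N) (v w : TangentSpace I x) : ⟪S.φ x v, w⟫_ℝ = - ⟪v, S.φ x w⟫_ℝ := by
  have h := S.inner_φ_φ x v (S.φ x w)
  rw [S.φ_φ, S.η_φ, mul_zero, sub_zero, inner_add_right, inner_neg_right, inner_smul_right,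
    S.inner_ξ, S.η_φ, mul_zero, add_zero] at h
  linarith

/-- The fundamental 2-form as a continuous bilinear form. -/
def fundamentalFormCLM (x : N) : TangentSpace I x →L[ℝ] TangentSpace I x →L[ℝ] ℝ :=
  ContinuousLinearMap.flip ((innerSL ℝ (E := TangentSpace I x)).flip.comp (S.φ x))

lemma fundamentalFormCLM_apply (x : N) (v w : TangentSpace I x) :
    S.fundamentalFormCLM x v w = ⟪v, S.φ x w⟫_ℝ := rfl

lemma fundamentalFormCLM_swap (x : N) (v w : TangentSpace I x) :
    S.fundamentalFormCLM x v w = - S.fundamentalFormCLM x w v := by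
  rw [fundamentalFormCLM_apply, fundamentalFormCLM_apply, real_inner_comm, inner_φ_left]

lemma smoothOneForm_η : SmoothOneForm S.η := by
  intro p X hX
  have h := ContMDiffAt.clm_bundle_apply (F₁ := E) (F₂ := ℝ)
    (E₁ := fun x : N => TangentSpace I x) (E₂ := Bundle.Trivial N ℝ)
    (b := fun x : N => x) (S.contMDiff_η p) hX
  exact (contMDiffAt_totalSpace.1 h).2

lemma smoothFieldAt_φField {X : ∀ x : N, TangentSpace I x} {p : N} (hX : SmoothFieldAt X p) :
    SmoothFieldAt (S.φField X) p :=
  ContMDiffAt.clm_bundle_apply (F₁ := E) (F₂ := E)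
    (E₁ := fun x : N => TangentSpace I x) (E₂ := fun x : N => TangentSpace I x)
    (b := fun x : N => x) (S.contMDiff_φ p) hX

variable [IsContMDiffRiemannianBundle I ∞ E (fun x : N => TangentSpace I x)]

lemma smoothTwoForm_fundamentalForm : SmoothTwoForm S.fundamentalFormCLM := by
  intro p X Y hX hY
  exact ContMDiffAt.inner_bundle (F := E) (E := fun x : N => TangentSpace I x)
    (b := fun x : N => x) hX (S.smoothFieldAt_φField hY)

end AlmostContactMetric

/-! ### The Levi-Civita connection -/

section LeviCivita

variable {E : Type*} [NormedAddCommGroup E] [NormedSpace ℝ E] [FiniteDimensional ℝ E]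
  {H : Type*} [TopologicalSpace H] {I : ModelWithCorners ℝ E H}
  {N : Type*} [TopologicalSpace N] [ChartedSpace H N] [IsManifold I ∞ N]
  [RiemannianBundle (fun x : N => TangentSpace I x)]
  [IsContMDiffRiemannianBundle I ∞ E (fun x : N => TangentSpace I x)]
  {cov : CovariantDerivative I E (TangentSpace I : N → Type _)}
  {X Y Z : ∀ x : N, TangentSpace I x} {p : N}

lemma IsLeviCivita.mvfderiv_inner (hcov : IsLeviCivita cov) (X : ∀ x : N, TangentSpace I x)
    (hY : SmoothFieldAt Y p) (hZ : SmoothFieldAt Z p) :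
    mvfderiv I (fun x => ⟪Y x, Z x⟫_ℝ) p (X p) =
      ⟪cov Y p (X p), Z p⟫_ℝ + ⟪Y p, cov Z p (X p)⟫_ℝ :=
  hcov.2.mvfderiv_inner_eq X (hY.mdifferentiableAt (by simp)) (hZ.mdifferentiableAt (by simp))

lemma IsLeviCivita.mlieBracket_eq (hcov : IsLeviCivita cov)
    (hX : SmoothFieldAt X p) (hY : SmoothFieldAt Y p) :
    VectorField.mlieBracket I X Y p = cov Y p (X p) - cov X p (Y p) := by
  have : CompleteSpace E := FiniteDimensional.complete ℝ E
  have : IsManifold I 2 N := .of_le (n := ∞) two_le_infty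
  have h := cov.torsion_apply (hX.mdifferentiableAt (by simp)) (hY.mdifferentiableAt (by simp))
  rw [hcov.1] at h
  exact (sub_eq_zero.1 (h.symm.trans rfl)).symm

namespace AlmostContactMetric

variable {S : AlmostContactMetric I N}

lemma IsKenmotsu.extDerivOne_eq_zero (hS : S.IsKenmotsu)
    (hX : SmoothFieldAt X p) (hY : SmoothFieldAt Y p) : extDerivOne S.η X Y p = 0 := by
  obtain ⟨cov, hcov, hφ⟩ := hS
  have hξ : SmoothFieldAt S.ξ p := S.contMDiff_ξ p
  have hcovξ (V W : ∀ x : N, TangentSpace I x) (hV : SmoothFieldAt V p) (hW : SmoothFieldAt W p) :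
      ⟪W p, cov S.ξ p (V p)⟫_ℝ = ⟪V p, W p⟫_ℝ - S.η p (V p) * S.η p (W p) := by
    have h0 : S.φField S.ξ = 0 := by
      ext1 x
      exact S.φ_ξ x
    have h1 := hφ p V S.ξ hV hξ
    have hz : cov (S.φField S.ξ) p (V p) = 0 := by
      rw [h0, CovariantDerivative.zero]
      rfl
    rw [hz, S.inner_ξ, S.η_φ, S.η_ξ, zero_smul, one_smul, zero_sub, zero_sub, neg_inj] at h1
    have h2 := hcov.mvfderiv_inner V hξ hξ
    have h3 : mvfderiv I (fun x => ⟪S.ξ x, S.ξ x⟫_ℝ) p (V p) = 0 := by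
      have : (fun x => ⟪S.ξ x, S.ξ x⟫_ℝ) = fun _ => (1 : ℝ) := by
        ext x
        rw [S.inner_ξ, S.η_ξ]
      rw [this, mvfderiv_const]
      rfl
    rw [h3, real_inner_comm (cov S.ξ p (V p)) (S.ξ p), S.inner_ξ] at h2
    have h4 := S.inner_φ_φ p (cov S.ξ p (V p)) (W p)
    rw [h1, S.inner_φ_φ, real_inner_comm (W p) (cov S.ξ p (V p))] at h4
    have h5 : S.η p (cov S.ξ p (V p)) = 0 := by linarith
    rw [h5] at h4
    linarith
  have hd (V W : ∀ x : N, TangentSpace I x) (hW : SmoothFieldAt W p) :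
      mvfderiv I (fun x => S.η x (W x)) p (V p) =
        S.η p (cov W p (V p)) + ⟪W p, cov S.ξ p (V p)⟫_ℝ := by
    have h1 := hcov.mvfderiv_inner V hW hξ
    simp only [S.inner_ξ] at h1
    exact h1
  rw [extDerivOne, hd X Y hY, hd Y X hX, hcov.mlieBracket_eq hX hY, map_sub, hcovξ X Y hX hY,
    hcovξ Y X hY hX, real_inner_comm]
  ring

lemma IsKenmotsu.extDerivTwo_eq_zero (hS : S.IsKenmotsu)
    (hX : SmoothFieldAt X p) (hY : SmoothFieldAt Y p) (hZ : SmoothFieldAt Z p)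
    (hX' : S.η p (X p) = 0) (hY' : S.η p (Y p) = 0) (hZ' : S.η p (Z p) = 0) :
    extDerivTwo S.fundamentalForm X Y Z p = 0 := by
  obtain ⟨cov, hcov, hφ⟩ := hS
  have hd (U V W : ∀ x : N, TangentSpace I x) (hU : SmoothFieldAt U p) (hV : SmoothFieldAt V p)
      (hW : SmoothFieldAt W p) (hV' : S.η p (V p) = 0) (hW' : S.η p (W p) = 0) :
      mvfderiv I (fun x => S.fundamentalForm x (V x) (W x)) p (U p) =
        ⟪cov V p (U p), S.φ p (W p)⟫_ℝ - ⟪S.φ p (V p), cov W p (U p)⟫_ℝ := by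
    have h1 := hcov.mvfderiv_inner U hV (S.smoothFieldAt_φField hW)
    have h2 := hφ p U W hU hW
    rw [hW', zero_smul, sub_zero, sub_eq_iff_eq_add] at h2
    rw [h2, inner_add_right, inner_smul_right, S.inner_ξ, hV', mul_zero, zero_add] at h1
    rw [S.inner_φ_left]
    rw [sub_neg_eq_add]
    exact h1
  rw [extDerivTwo, hd X Y Z hX hY hZ hY' hZ', hd Y Z X hY hZ hX hZ' hX', hd Z X Y hZ hX hY hX' hY',
    hcov.mlieBracket_eq hX hY, hcov.mlieBracket_eq hY hZ, hcov.mlieBracket_eq hZ hX]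
  simp only [fundamentalForm, inner_sub_left]
  rw [real_inner_comm (S.φ p (X p)) (cov Y p (Z p)), real_inner_comm (S.φ p (Y p)) (cov Z p (X p)),
    real_inner_comm (S.φ p (Z p)) (cov X p (Y p))]
  ring

end AlmostContactMetric

end LeviCivita

/-! ### Warped product pointwise semi-slant submanifolds with invariant fiber -/

section SemiSlant

variable {E : Type*} [NormedAddCommGroup E] [NormedSpace ℝ E] [FiniteDimensional ℝ E]
  {H : Type*} [TopologicalSpace H] {I : ModelWithCorners ℝ E H}
  {N : Type*} [TopologicalSpace N] [ChartedSpace H N] [IsManifold I ∞ N]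
  [RiemannianBundle (fun x : N => TangentSpace I x)]
  {E₁ : Type*} [NormedAddCommGroup E₁] [NormedSpace ℝ E₁]
  {H₁ : Type*} [TopologicalSpace H₁] {I₁ : ModelWithCorners ℝ E₁ H₁}
  {B : Type*} [TopologicalSpace B] [ChartedSpace H₁ B] [IsManifold I₁ ∞ B]
  [RiemannianBundle (fun x : B => TangentSpace I₁ x)]
  {E₂ : Type*} [NormedAddCommGroup E₂] [NormedSpace ℝ E₂]
  {H₂ : Type*} [TopologicalSpace H₂] {I₂ : ModelWithCorners ℝ E₂ H₂}
  {F : Type*} [TopologicalSpace F] [ChartedSpace H₂ F] [IsManifold I₂ ∞ F]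
  [RiemannianBundle (fun x : F => TangentSpace I₂ x)]
  {S : AlmostContactMetric I N} {f : B → ℝ} {ι : B × F → N}

omit [FiniteDimensional ℝ E] [IsManifold I ∞ N] [IsManifold I₁ ∞ B] [IsManifold I₂ ∞ F] in
lemma IsWarpedProductSubmanifold.inner_mfderiv
    (hι : IsWarpedProductSubmanifold I₁ I₂ I f ι) (p : B × F) (v w : E₁ × E₂) :
    ⟪mfderiv (I₁.prod I₂) I ι p v, mfderiv (I₁.prod I₂) I ι p w⟫_ℝ =
      inner (E := TangentSpace I₁ p.1) ℝ v.1 w.1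
        + f p.1 ^ 2 * inner (E := TangentSpace I₂ p.2) ℝ v.2 w.2 := by
  have h (v w : TangentSpace (I₁.prod I₂) p) : warpedMetric I₁ I₂ f p v w =
      inner (E := TangentSpace I₁ p.1) ℝ (Prod.fst (α := E₁) (β := E₂) v)
        (Prod.fst (α := E₁) (β := E₂) w)
      + f p.1 ^ 2 * inner (E := TangentSpace I₂ p.2) ℝ (Prod.snd (α := E₁) (β := E₂) v)
        (Prod.snd (α := E₁) (β := E₂) w) := by
    rw [warpedMetric, mfderiv_fst, mfderiv_snd]
    rfl
  exact (hι.2 p v w).trans (h v w)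

omit [FiniteDimensional ℝ E] [IsManifold I ∞ N] [IsManifold I₁ ∞ B] [IsManifold I₂ ∞ F] in
lemma IsWarpedProductSubmanifold.inner_fiber
    (hι : IsWarpedProductSubmanifold I₁ I₂ I f ι) (p : B × F) (z w : E₂) :
    ⟪mfderiv (I₁.prod I₂) I ι p ((0 : E₁), z), mfderiv (I₁.prod I₂) I ι p ((0 : E₁), w)⟫_ℝ =
      f p.1 ^ 2 * inner (E := TangentSpace I₂ p.2) ℝ z w := by
  refine (hι.inner_mfderiv p _ _).trans ?_
  have : inner (E := TangentSpace I₁ p.1) ℝ 0 0 = 0 := inner_zero_left _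
  exact (congrArg (· + _) this).trans (zero_add _)

omit [FiniteDimensional ℝ E] [IsManifold I ∞ N] [IsManifold I₁ ∞ B] [IsManifold I₂ ∞ F] in
lemma IsWarpedProductSubmanifold.inner_base_fiber
    (hι : IsWarpedProductSubmanifold I₁ I₂ I f ι) (p : B × F) (x : E₁) (w : E₂) :
    ⟪mfderiv (I₁.prod I₂) I ι p (x, (0 : E₂)), mfderiv (I₁.prod I₂) I ι p ((0 : E₁), w)⟫_ℝ = 0 := by
  refine (hι.inner_mfderiv p _ _).trans ?_
  have h1 : inner (E := TangentSpace I₁ p.1) ℝ x 0 = 0 := inner_zero_right _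
  have h2 : inner (E := TangentSpace I₂ p.2) ℝ 0 w = 0 := inner_zero_left _
  refine (congrArg₂ (fun a b => a + f p.1 ^ 2 * b) h1 h2).trans ?_
  simp

omit [FiniteDimensional ℝ E] [IsManifold I ∞ N] [IsManifold I₁ ∞ B] [IsManifold I₂ ∞ F] in
lemma IsWarpedProductSubmanifold.mfderiv_base_ne_zero
    (hι : IsWarpedProductSubmanifold I₁ I₂ I f ι) (p : B × F) {x : E₁} (hx : x ≠ 0) :
    mfderiv (I₁.prod I₂) I ι p (x, (0 : E₂)) ≠ 0 := by
  intro h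
  have h1 := hι.inner_mfderiv p (x, (0 : E₂)) (x, (0 : E₂))
  have h2 : inner (E := TangentSpace I₂ p.2) ℝ 0 0 = 0 := inner_zero_left _
  rw [h, inner_zero_left] at h1
  have h3 : (0 : ℝ) = inner (E := TangentSpace I₁ p.1) ℝ x x :=
    h1.trans ((congrArg (fun b => _ + f p.1 ^ 2 * b) h2).trans (by simp))
  exact hx ((inner_self_eq_zero (𝕜 := ℝ) (E := TangentSpace I₁ p.1)).1 h3.symm)

omit [IsManifold I₁ ∞ B] [IsManifold I₂ ∞ F] [RiemannianBundle (fun x : B => TangentSpace I₁ x)]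
  [RiemannianBundle (fun x : F => TangentSpace I₂ x)] in
lemma mem_fiberDistribution {p : B × F} {v : TangentSpace (I₁.prod I₂) p} :
    v ∈ fiberDistribution I₁ I₂ p ↔ v.1 = 0 := by
  rw [fiberDistribution, mfderiv_fst]
  exact LinearMap.mem_ker

omit [IsManifold I₁ ∞ B] [IsManifold I₂ ∞ F] [RiemannianBundle (fun x : B => TangentSpace I₁ x)]
  [RiemannianBundle (fun x : F => TangentSpace I₂ x)] in
lemma mem_baseDistribution {p : B × F} {v : TangentSpace (I₁.prod I₂) p} :
    v ∈ baseDistribution I₁ I₂ p ↔ v.2 = 0 := by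
  rw [baseDistribution, mfderiv_snd]
  exact LinearMap.mem_ker

/-- The fibers of `B × F` are invariant under `φ`. -/
def FiberInvariant (I₁ : ModelWithCorners ℝ E₁ H₁) (I₂ : ModelWithCorners ℝ E₂ H₂)
    (S : AlmostContactMetric I N) (ι : B × F → N) : Prop :=
  ∀ (p : B × F) (z : E₂), ∃ w : E₂, S.φ (ι p) (mfderiv (I₁.prod I₂) I ι p ((0 : E₁), z)) =
    mfderiv (I₁.prod I₂) I ι p ((0 : E₁), w)

omit [FiniteDimensional ℝ E] [RiemannianBundle (fun x : B => TangentSpace I₁ x)]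
  [RiemannianBundle (fun x : F => TangentSpace I₂ x)] in
lemma IsPointwiseSemiSlant.fiberInvariant {θ : B × F → ℝ}
    (hs : IsPointwiseSemiSlant (I₁.prod I₂) S ι (fiberDistribution I₁ I₂)
      (baseDistribution I₁ I₂) θ) : FiberInvariant I₁ I₂ S ι := by
  intro p z
  obtain ⟨w, hw, hφ⟩ := hs.φ_D₁ p ((0 : E₁), z) (mem_fiberDistribution.2 rfl)
  refine ⟨w.2, hφ.trans (congrArg _ (Prod.ext ?_ rfl))⟩
  exact mem_fiberDistribution.1 hw

omit [FiniteDimensional ℝ E] in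
lemma FiberInvariant.fundamentalForm_base_fiber (hinv : FiberInvariant I₁ I₂ S ι)
    (hι : IsWarpedProductSubmanifold I₁ I₂ I f ι) (p : B × F) (x : E₁) (z : E₂) :
    S.fundamentalFormCLM (ι p) (mfderiv (I₁.prod I₂) I ι p (x, (0 : E₂)))
      (mfderiv (I₁.prod I₂) I ι p ((0 : E₁), z)) = 0 := by
  obtain ⟨w, hw⟩ := hinv p z
  rw [S.fundamentalFormCLM_apply, hw]
  exact hι.inner_base_fiber p x w

omit [FiniteDimensional ℝ E] in
/-- A tangent characteristic vector field is tangent to the fibers. -/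
lemma IsProperPointwiseSemiSlant.ξ_tangent_fiber
    (hs : IsProperPointwiseSemiSlant (I₁.prod I₂) S ι (fiberDistribution I₁ I₂)
      (baseDistribution I₁ I₂))
    (hι : IsWarpedProductSubmanifold I₁ I₂ I f ι) (hξ : XiTangent (I₁.prod I₂) S ι) (p : B × F) :
    ∃ z : E₂, mfderiv (I₁.prod I₂) I ι p ((0 : E₁), z) = S.ξ (ι p) := by
  obtain ⟨θ, hθ, hs⟩ := hs
  obtain ⟨v, hv⟩ := hξ p
  obtain ⟨x, z⟩ : E₁ × E₂ := v
  by_cases hx : x = 0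
  · exact ⟨z, by rw [← hv, hx]⟩
  exfalso
  obtain ⟨w, hw⟩ := hs.fiberInvariant p z
  have hsplit : S.φ (ι p) (mfderiv (I₁.prod I₂) I ι p (x, (0 : E₂))) =
      - mfderiv (I₁.prod I₂) I ι p ((0 : E₁), w) := by
    have h1 : ((x, z) : E₁ × E₂) = (x, 0) + (0, z) := by simp
    have h2 : mfderiv (I₁.prod I₂) I ι p (x, z) = mfderiv (I₁.prod I₂) I ι p (x, (0 : E₂))
        + mfderiv (I₁.prod I₂) I ι p ((0 : E₁), z) :=
      (congrArg _ h1).trans (map_add (mfderiv (I₁.prod I₂) I ι p) _ _)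
    rw [← hw, eq_neg_iff_add_eq_zero, ← map_add, ← h2, ← S.φ_ξ (ι p)]
    exact congrArg _ hv
  have hx0 : ((x, 0) : E₁ × E₂) ≠ 0 := fun h => hx (congrArg Prod.fst h)
  have hangle := (hs.slant p (x, (0 : E₂)) (mem_baseDistribution.2 rfl) hx0).2
  have hset : (fun w => InnerProductGeometry.angle
      (S.φ (ι p) (mfderiv (I₁.prod I₂) I ι p (x, (0 : E₂)))) w) ''
      {w | w ∈ (baseDistribution I₁ I₂ p).map (mfderiv (I₁.prod I₂) I ι p :
        TangentSpace (I₁.prod I₂) p →ₗ[ℝ] TangentSpace I (ι p)) ∧ w ≠ 0} = {Real.pi / 2} := by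
    refine Set.eq_singleton_iff_nonempty_unique_mem.2 ⟨⟨_, _, ⟨⟨(x, (0 : E₂)),
      mem_baseDistribution.2 rfl, rfl⟩, hι.mfderiv_base_ne_zero p hx⟩, rfl⟩, ?_⟩
    rintro _ ⟨_, ⟨⟨⟨x', z'⟩, hb, rfl⟩, -⟩, rfl⟩
    have hz' : z' = 0 := mem_baseDistribution.1 hb
    refine InnerProductGeometry.inner_eq_zero_iff_angle_eq_pi_div_two _ _ |>.1 ?_
    rw [hsplit, inner_neg_left, real_inner_comm, hz', neg_eq_zero]
    exact hι.inner_base_fiber p x' w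
  rw [angleSubspace, hset, csInf_singleton] at hangle
  exact (hθ p).2.ne hangle.symm

variable [IsContMDiffRiemannianBundle I ∞ E (fun x : N => TangentSpace I x)]
  [I.Boundaryless] [I₁.Boundaryless] [I₂.Boundaryless]

lemma warping_eq_of_ξ_tangent [PreconnectedSpace B] [Nonempty F]
    (hN : S.IsCosymplectic ∨ S.IsSasakian ∨ S.IsKenmotsu) (hf_pos : ∀ x, 0 < f x)
    (hι : IsWarpedProductSubmanifold I₁ I₂ I f ι)
    (hinv : FiberInvariant I₁ I₂ S ι)
    (hξ : ∀ p : B × F, ∃ z : E₂, mfderiv (I₁.prod I₂) I ι p ((0 : E₁), z) = S.ξ (ι p))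
    (b b' : B) : f b = f b' := by
  obtain ⟨q⟩ := ‹Nonempty F›
  choose ζ hζ using hξ
  have hη (p : B × F) (v : E₁ × E₂) : S.η (ι p) (mfderiv (I₁.prod I₂) I ι p v) =
      ⟪mfderiv (I₁.prod I₂) I ι p v, mfderiv (I₁.prod I₂) I ι p ((0 : E₁), ζ p)⟫_ℝ := by
    rw [hζ, S.inner_ξ]
  have hconst := oneForm_constant_along_base (I₁ := I₁) (I₂ := I₂) S.smoothOneForm_η hι.1
    (fun p x => (hη p _).trans (hι.inner_base_fiber p x _)) (fun p x z X Y hX hY hXp hYp => by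
      rcases hN with h | h | h
      · exact h.1.1 _ X Y hX hY
      · refine (h.1 _ X Y hX hY).symm.trans ?_
        rw [hXp, hYp]
        exact hinv.fundamentalForm_base_fiber hι p x z
      · exact h.extDerivOne_eq_zero hX hY)
  have hconst' (z : TangentSpace I₂ q) (b b' : B) :
      f b ^ 2 * inner (E := TangentSpace I₂ q) ℝ z (ζ (b, q)) =
        f b' ^ 2 * inner (E := TangentSpace I₂ q) ℝ z (ζ (b', q)) := by
    have h := hconst q z b b'
    rw [hη, hη] at h
    exact (hι.inner_fiber (b, q) z _).symm.trans (h.trans (hι.inner_fiber (b', q) z _))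
  have hnorm (b : B) :
      f b ^ 2 * inner (E := TangentSpace I₂ q) ℝ (ζ (b, q)) (ζ (b, q)) = 1 := by
    refine (hι.inner_fiber (b, q) _ _).symm.trans ?_
    rw [hζ, S.inner_ξ, S.η_ξ]
  have h1 := hconst' (ζ (b, q)) b b'
  have h2 := hconst' (ζ (b', q)) b b'
  rw [hnorm] at h1 h2
  have hcomm : inner (E := TangentSpace I₂ q) ℝ (ζ (b', q)) (ζ (b, q)) =
      inner (E := TangentSpace I₂ q) ℝ (ζ (b, q)) (ζ (b', q)) := real_inner_comm _ _
  rw [hcomm] at h2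
  have hb := hf_pos b
  have hb' := hf_pos b'
  set t := inner (E := TangentSpace I₂ q) ℝ (ζ (b, q)) (ζ (b', q))
  have ht : t ≠ 0 := by
    rintro h
    rw [h] at h1
    simp at h1
  have h3 : f b ^ 2 * t = f b' ^ 2 * t := h2.trans h1
  exact (pow_left_inj₀ hb.le hb'.le two_ne_zero).1 (mul_right_cancel₀ ht h3)

omit [IsContMDiffRiemannianBundle I ∞ E (fun x : N => TangentSpace I x)] in
/-- A contact metric manifold has no submanifold with invariant fibers which is normal to `ξ`. -/
lemma not_xiNormal_of_isContact [Nonempty B] [Nonempty F] [Nontrivial E₂]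
    (hN : S.IsContact) (hf_pos : ∀ x, 0 < f x)
    (hι : IsWarpedProductSubmanifold I₁ I₂ I f ι)
    (hinv : FiberInvariant I₁ I₂ S ι) (hξ : XiNormal (I₁.prod I₂) S ι) : False := by
  obtain ⟨q⟩ := ‹Nonempty F›
  obtain ⟨b⟩ := ‹Nonempty B›
  obtain ⟨w, hw⟩ := exists_ne (0 : E₂)
  obtain ⟨z, hz⟩ := hinv (b, q) w
  have hη (p : B × F) (v : E₁ × E₂) : S.η (ι p) (mfderiv (I₁.prod I₂) I ι p v) = 0 := by
    rw [← S.inner_ξ, real_inner_comm]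
    exact hξ p v
  obtain ⟨X, Y, hX, hY, hXz, hYw, hd⟩ :=
    exists_extDerivOne_eq_zero S.smoothOneForm_η hι.1 hη (b, q) z w
  have h1 := hN _ X Y hX hY
  rw [hd, hXz, hYw, AlmostContactMetric.fundamentalForm, hz, ← hz, S.inner_φ_φ, hη, mul_zero,
    sub_zero] at h1
  have h2 := (hι.inner_fiber (b, q) w w).symm.trans h1
  rcases mul_eq_zero.1 h2 with h | h
  · exact (pow_pos (hf_pos b) 2).ne' h
  · exact hw ((inner_self_eq_zero (𝕜 := ℝ) (E := TangentSpace I₂ q)).1 h)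

lemma warping_eq_of_ξ_normal [PreconnectedSpace B] [Nonempty F] [Nontrivial E₂]
    (hN : S.IsCosymplectic ∨ S.IsKenmotsu) (hf_pos : ∀ x, 0 < f x)
    (hι : IsWarpedProductSubmanifold I₁ I₂ I f ι)
    (hinv : FiberInvariant I₁ I₂ S ι) (hξ : XiNormal (I₁.prod I₂) S ι)
    (b b' : B) : f b = f b' := by
  obtain ⟨q⟩ := ‹Nonempty F›
  obtain ⟨w, hw⟩ := exists_ne (0 : E₂)
  choose J hJ using hinv
  have hη (p : B × F) (v : E₁ × E₂) : S.η (ι p) (mfderiv (I₁.prod I₂) I ι p v) = 0 := by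
    rw [← S.inner_ξ, real_inner_comm]
    exact hξ p v
  have hnorm (b : B) : inner (E := TangentSpace I₂ q) ℝ (J (b, q) w) (J (b, q) w) =
      inner (E := TangentSpace I₂ q) ℝ w w := by
    have h := S.inner_φ_φ (ι (b, q)) (mfderiv (I₁.prod I₂) I ι (b, q) ((0 : E₁), w))
      (mfderiv (I₁.prod I₂) I ι (b, q) ((0 : E₁), w))
    rw [hη, mul_zero, sub_zero, hJ] at h
    have h' := (hι.inner_fiber (b, q) (J (b, q) w) (J (b, q) w)).symm.trans
      (h.trans (hι.inner_fiber (b, q) w w))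
    exact mul_left_cancel₀ (pow_pos (hf_pos b) 2).ne' h'
  have hw0 : inner (E := TangentSpace I₂ q) ℝ w w ≠ 0 :=
    fun h => hw ((inner_self_eq_zero (𝕜 := ℝ) (E := TangentSpace I₂ q)).1 h)
  have hconst (z : TangentSpace I₂ q) (b b' : B) :
      f b ^ 2 * inner (E := TangentSpace I₂ q) ℝ z (J (b, q) w) =
        f b' ^ 2 * inner (E := TangentSpace I₂ q) ℝ z (J (b', q) w) := by
    have hd (p : B × F) (X Y Z : ∀ x : N, TangentSpace I x) (hX : SmoothFieldAt X (ι p))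
        (hY : SmoothFieldAt Y (ι p)) (hZ : SmoothFieldAt Z (ι p))
        (hXp : S.η (ι p) (X (ι p)) = 0) (hYp : S.η (ι p) (Y (ι p)) = 0)
        (hZp : S.η (ι p) (Z (ι p)) = 0) : extDerivTwo S.fundamentalForm X Y Z (ι p) = 0 := by
      rcases hN with h | h
      · exact h.1.2 _ X Y Z hX hY hZ
      · exact h.extDerivTwo_eq_zero hX hY hZ hXp hYp hZp
    have h' := twoForm_constant_along_base (I₁ := I₁) (I₂ := I₂) S.smoothTwoForm_fundamentalForm
      S.fundamentalFormCLM_swap hι.1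
      (FiberInvariant.fundamentalForm_base_fiber (fun p z => ⟨J p z, hJ p z⟩) hι)
      (fun p x z w X Y Z hX hY hZ hXp hYp hZp => hd p X Y Z hX hY hZ (by rw [hXp, hη])
        (by rw [hYp, hη]) (by rw [hZp, hη])) q z w b b'
    rw [S.fundamentalFormCLM_apply, S.fundamentalFormCLM_apply, hJ, hJ] at h'
    exact (hι.inner_fiber (b, q) z _).symm.trans (h'.trans (hι.inner_fiber (b', q) z _))
  have h1 := hconst (J (b, q) w) b b'
  have h2 := hconst (J (b', q) w) b b'
  rw [hnorm] at h1 h2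
  have hcomm : inner (E := TangentSpace I₂ q) ℝ (J (b', q) w) (J (b, q) w) =
      inner (E := TangentSpace I₂ q) ℝ (J (b, q) w) (J (b', q) w) := real_inner_comm _ _
  rw [hcomm] at h2
  have hb := hf_pos b
  have hb' := hf_pos b'
  set c := inner (E := TangentSpace I₂ q) ℝ w w
  set t := inner (E := TangentSpace I₂ q) ℝ (J (b, q) w) (J (b', q) w)
  have h3 : (f b ^ 2) ^ 2 * c = (f b' ^ 2) ^ 2 * c := by
    linear_combination f b ^ 2 * h1 + f b' ^ 2 * h2
  exact (pow_left_inj₀ hb.le hb'.le two_ne_zero).1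
    ((pow_left_inj₀ (sq_nonneg _) (sq_nonneg _) two_ne_zero).1 (mul_right_cancel₀ hw0 h3))

end SemiSlant

end

theorem mainTheorem9 {n b k : ℕ} (hk : 1 ≤ k)
    {N : Type*} [TopologicalSpace N] [T2Space N] [SecondCountableTopology N]
    [ChartedSpace (EuclideanSpace ℝ (Fin (2 * n + 1))) N] [IsManifold (𝓡 (2 * n + 1)) ∞ N]
    [RiemannianBundle (fun x : N => TangentSpace (𝓡 (2 * n + 1)) x)]
    [IsContMDiffRiemannianBundle (𝓡 (2 * n + 1)) ∞ (EuclideanSpace ℝ (Fin (2 * n + 1)))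
      (fun x : N => TangentSpace (𝓡 (2 * n + 1)) x)]
    {B : Type*} [TopologicalSpace B] [T2Space B] [SecondCountableTopology B] [ConnectedSpace B]
    [ChartedSpace (EuclideanSpace ℝ (Fin b)) B] [IsManifold (𝓡 b) ∞ B]
    [RiemannianBundle (fun x : B => TangentSpace (𝓡 b) x)]
    [IsContMDiffRiemannianBundle (𝓡 b) ∞ (EuclideanSpace ℝ (Fin b))
      (fun x : B => TangentSpace (𝓡 b) x)]
    {F : Type*} [TopologicalSpace F] [T2Space F] [SecondCountableTopology F] [Nonempty F]
    [ChartedSpace (EuclideanSpace ℝ (Fin k)) F] [IsManifold (𝓡 k) ∞ F]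
    [RiemannianBundle (fun x : F => TangentSpace (𝓡 k) x)]
    [IsContMDiffRiemannianBundle (𝓡 k) ∞ (EuclideanSpace ℝ (Fin k))
      (fun x : F => TangentSpace (𝓡 k) x)]
    (S : AlmostContactMetric (𝓡 (2 * n + 1)) N)
    (hN : S.IsCosymplectic ∨ S.IsSasakian ∨ S.IsKenmotsu)
    (f : B → ℝ) (hf : ContMDiff (𝓡 b) 𝓘(ℝ, ℝ) ∞ f) (hf_pos : ∀ x, 0 < f x)
    (hf_nontrivial : ¬ ∃ c : ℝ, ∀ x, f x = c)
    (ι : B × F → N) (hι : IsWarpedProductSubmanifold (𝓡 b) (𝓡 k) (𝓡 (2 * n + 1)) f ι)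
    (hξ : XiNormal ((𝓡 b).prod (𝓡 k)) S ι ∨ XiTangent ((𝓡 b).prod (𝓡 k)) S ι) :
    ¬ IsProperPointwiseSemiSlant ((𝓡 b).prod (𝓡 k)) S ι
      (fiberDistribution (𝓡 b) (𝓡 k)) (baseDistribution (𝓡 b) (𝓡 k)) := by
  have : Nonempty (Fin k) := ⟨⟨0, hk⟩⟩
  intro hs
  have hinv : FiberInvariant (𝓡 b) (𝓡 k) S ι := by
    obtain ⟨θ, -, hθ⟩ := hs
    exact hθ.fiberInvariant
  obtain ⟨b₀⟩ := ‹ConnectedSpace B›.toNonempty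
  refine hf_nontrivial ⟨f b₀, fun x => ?_⟩
  rcases hξ with hξ | hξ
  · rcases hN with h | h | h
    · exact warping_eq_of_ξ_normal (Or.inl h) hf_pos hι hinv hξ x b₀
    · exact (not_xiNormal_of_isContact h.1 hf_pos hι hinv hξ).elim
    · exact warping_eq_of_ξ_normal (Or.inr h) hf_pos hι hinv hξ x b₀
  · exact warping_eq_of_ξ_tangent hN hf_pos hι hinv (hs.ξ_tangent_fiber hι hξ) x b₀
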